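/- **Setting.** Let $\mathcal U$ be a finite non-empty set of users, partitioned into clusters $\mathcal V_1,\dots,\mathcal V_J$, and let $j(u)$ be the index of the cluster of $u$. All users of $\mathcal V_j$ share an unknown preference vector $\theta^j\in\mathbb R^d$ with $\|\theta^j\|_2\le 1$, and different clusters have different vectors. There are $I\ge K\ge 1$ items. In each round $t=1,\dots,T$ a user $u_t$ arrives; a set $\mathcal I_t$ of available items with features $x_{t,i}\in\mathbb R^d$, $\|x_{t,i}\|_2\le1$, and a non-empty set $\mathcal A_t$ of feasible actions (lists of between $1$ and $K$ distinct items of $\mathcal I_t$) are revealed. These may depend on the past in any way (in particular they may be random and i.i.d.). The agent of $u_t$ plays $a_t\in\mathcal A_t$; the user checks the items of $a_t$ in order and stops after the first click. The items checked, and whether each was clicked, are observed; let $n_t\le K$ be the number of checked items $a_{1,t},\dots,a_{n_t,t}$. Given the history up to and including the revelation of $u_t,\mathcal I_t,\mathcal A_t,(x_{t,i})_i$, the clicks $w_t(i)\in\{0,1\}$, $i\in\mathcal I_t$, are independent with means $\langle\theta^{j(u_t)},x_{t,i}\rangle$. For a positive semi-definite matrix $M$ write $\|x\|_M=\sqrt{x^\top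 Mx}$. **Algorithm** (FedC$^3$UCB-H, parameters $\alpha_c,\alpha_d,\lambda>0$, and $\beta$ given below). Each agent $u$ holds $\Sigma_{u,t},\hat\theta_{u,t}$ for decisions and local data $\Sigma^{loc}_u,b^{loc}_u,T^{loc}_u$; the server stores $\Sigma^{ser}_u,b^{ser}_u,T^{ser}_u$ for each $u$. All of these start at $0$. The server also has a graph $G$ on $\mathcal U$, initially complete. In round $t$: 1. Agent $u=u_t$ computes $U_t(i)=\min\{\hat\theta_{u,t}^\top x_{t,i}+\beta\|x_{t,i}\|_{\Sigma_{u,t}^{-1}},1\}$ for $i\in\mathcal I_t$ and plays the action of $\mathcal A_t$ that a (measurable) offline oracle selects from these numbers. It adds $\sum_{k\le n_t}x_{t,a_{k,t}}x_{t,a_{k,t}}^\top$, $\sum_{k\le n_t}w_t(a_{k,t})x_{t,a_{k,t}}$ and $n_t$ to its local data $\Sigma_u^{loc},b_u^{loc},T_u^{loc}$, and draws a fresh uniform $p\in[0,1]$, independent of the past and of the feedback of the round. 2. If $\det(\Sigma_{u,t}+\Sigma^{loc}_u)>(1+\alpha_c)\det(\Sigma_{u,t})$ or $p<3\log t/t$,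 then $u$ communicates: its local data are added to its server data and reset to $0$; with $\mathcal V$ the connected component of $u$ in the current graph $G$, the agent receives $\Sigma_{u,t+1}=\lambda I+\sum_{v\in\mathcal V}\Sigma^{ser}_v$ and $\hat\theta_{u,t+1}=\Sigma_{u,t+1}^{-1}\sum_{v\in\mathcal V}b^{ser}_v$. Then, with $\hat\theta^{ser}_v=(\lambda I+\Sigma_v^{ser})^{-1}b_v^{ser}$ and $g(n)=\sqrt{(1+\ln(1+n))/(1+n)}$, the server deletes every edge $(u,v)$ with $\|\hat\theta_u^{ser}-\hat\theta_v^{ser}\|_2>\alpha_d\,(g(T^{ser}_u)+g(T^{ser}_v))$. 3. Everything else is unchanged. **Correct clusters.** Let $N_v(t)$ be the last round $\le t$ in which agent $v$ communicated ($0$ if there is none). For an agent $u$ and a round $t$ put $r=N_u(t-1)$. The clusters are called *correct for $(u,t)$* if every agent $v\in\mathcal V_{j(u)}$ that was active in some round $\le r$ (this includes $u$ itself if $r\ge1$) satisfies $N_v(r)\ge 1$, and in round $N_v(r)$ the server's connected component of $v$ was exactly the true cluster $\mathcal V_{j(u)}$. That is, the aggregate that $u$ uses in round $t$, and the aggregates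 held at the time of its synchronization by the active agents of its cluster, were computed over the true cluster, however old they are. **Lemma (local confidence bound).** Let $d,K,T\ge1$, $\alpha_c,\alpha_d,\lambda>0$, $\delta\in(0,1)$ and $$\beta=\sqrt\lambda+\left(\sqrt{1+|\mathcal U|\alpha_c}+|\mathcal U|\sqrt{2\alpha_c}\right)\sqrt{d\log\left(1+\tfrac{KT}{\alpha_c\lambda d}\right)+2\log\tfrac1\delta+4\log(T|\mathcal U|)}.$$ With probability at least $1-\delta$, the following holds simultaneously for all $t\in\{1,\dots,T\}$ and all $u\in\mathcal U$: if the clusters are correct for $(u,t)$, then $$\left\|\hat\theta_{u,t}-\theta^{j(u)}\right\|_{\Sigma_{u,t}}\le\beta .$$ -/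

import Mathlib

noncomputable section

namespace FedC3B

open MeasureTheory ProbabilityTheory Matrix

/-- The Euclidean norm of a vector of `ℝ^d`. -/
def l2norm {d : ℕ} (v : Fin d → ℝ) : ℝ := ‖(WithLp.toLp 2 v : EuclideanSpace ℝ (Fin d))‖

/-- The matrix norm `‖v‖_M = √(vᵀ M v)`, for `M` positive semi-definite. -/
def matNorm {d : ℕ} (M : Matrix (Fin d) (Fin d) ℝ) (v : Fin d → ℝ) : ℝ :=
  Real.sqrt (v ⬝ᵥ (M *ᵥ v))

/-- The confidence radius `β`, for `n` users, dimension `d`, actions of length at most `K`,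
horizon `T`, communication threshold `αc`, regularizer `lam` and confidence level `δ`. -/
def confRadius (n d K T : ℕ) (αc lam δ : ℝ) : ℝ :=
  Real.sqrt lam + (Real.sqrt (1 + n * αc) + n * Real.sqrt (2 * αc)) *
    Real.sqrt (d * Real.log (1 + K * T / (αc * lam * d)) + 2 * Real.log (1 / δ)
      + 4 * Real.log (T * n))

/-! ### The algorithm, on one sequence of inputs -/

/-- Everything that the algorithm is fed with in one round. Items are `Fin m`. Only the features
and clicks of the items in `avail` are ever used. -/
structure RoundInput (U : Type*) (m d : ℕ) where
  /-- the user who arrives -/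
  user : U
  /-- the items that are available in this round -/
  avail : Finset (Fin m)
  /-- the feasible actions: an action is an ordered list of items -/
  feas : Finset (List (Fin m))
  /-- the feature vectors of the items -/
  x : Fin m → Fin d → ℝ
  /-- whether the item would be clicked if it is checked -/
  w : Fin m → Bool
  /-- the random number drawn by the agent for the auxiliary communication -/
  coin : ℝ

/-- The input parameters of the algorithm, including the radius `β` that its upper confidence
bounds use and its offline oracle, which turns a feasible set and item weights into an action. -/
structure Params (m d : ℕ) where
  αc : ℝ
  αd : ℝ
  lam : ℝ
  β : ℝ
  oracle : Finset (List (Fin m)) → (Fin m → ℝ) → List (Fin m)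

/-- The data held by the agents and by the server between two rounds. -/
structure AlgState (U : Type*) (d : ℕ) where
  /-- the Gram matrix that agent `u` uses for its decisions -/
  gram : U → Matrix (Fin d) (Fin d) ℝ
  /-- the estimate that agent `u` uses for its decisions -/
  est : U → Fin d → ℝ
  /-- data collected by agent `u` and not uploaded yet -/
  locGram : U → Matrix (Fin d) (Fin d) ℝ
  locVec : U → Fin d → ℝ
  locCount : U → ℕ
  /-- data of agent `u` stored at the server -/
  serGram : U → Matrix (Fin d) (Fin d) ℝ
  serVec : U → Fin d → ℝ
  serCount : U → ℕ
  /-- the graph of the server on the agents -/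
  graph : SimpleGraph U

variable {U : Type*} [Fintype U] [DecidableEq U] {m d : ℕ}

/-- Initially all data vanish and the graph is complete. -/
def initState : AlgState U d where
  gram := fun _ => 0
  est := fun _ => 0
  locGram := fun _ => 0
  locVec := fun _ => 0
  locCount := fun _ => 0
  serGram := fun _ => 0
  serVec := fun _ => 0
  serCount := fun _ => 0
  graph := ⊤

/-- The connected component of `u` in the graph `G`. -/
def component (G : SimpleGraph U) (u : U) : Finset U :=
  open Classical in Finset.univ.filter fun v => G.Reachable u v

/-- The items of the action `a` that are checked: the user goes through `a` from the beginning and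
stops after the first clicked item, or at the end of `a` if no item is clicked. -/
def observed (w : Fin m → Bool) (a : List (Fin m)) : List (Fin m) := a.take (a.findIdx w + 1)

/-- The upper confidence bound of item `i` for the arriving user. -/
def ucb (P : Params m d) (inp : RoundInput U m d) (st : AlgState U d) (i : Fin m) : ℝ :=
  if i ∈ inp.avail then
    min (st.est inp.user ⬝ᵥ inp.x i + P.β * matNorm (st.gram inp.user)⁻¹ (inp.x i)) 1
  else 0

/-- The action that is played. -/
def action (P : Params m d) (inp : RoundInput U m d) (st : AlgState U d) : List (Fin m) :=
  P.oracle inp.feas (ucb P inp st)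

/-- The items observed in the round. -/
def obs (P : Params m d) (inp : RoundInput U m d) (st : AlgState U d) : List (Fin m) :=
  observed inp.w (action P inp st)

/-- The local data of the arriving user's agent after the observations of the round. -/
def newLocGram (P : Params m d) (inp : RoundInput U m d) (st : AlgState U d) :
    Matrix (Fin d) (Fin d) ℝ :=
  st.locGram inp.user + ((obs P inp st).map fun i => vecMulVec (inp.x i) (inp.x i)).sum

def newLocVec (P : Params m d) (inp : RoundInput U m d) (st : AlgState U d) : Fin d → ℝ :=
  st.locVec inp.user +
    ((obs P inp st).map fun i => (if inp.w i then (1 : ℝ) else 0) • inp.x i).sum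

def newLocCount (P : Params m d) (inp : RoundInput U m d) (st : AlgState U d) : ℕ :=
  st.locCount inp.user + (obs P inp st).length

/-- The communication condition of round `t`: determinant test, or auxiliary communication with
probability `3 log t / t`. -/
def Communicates (P : Params m d) (t : ℕ) (inp : RoundInput U m d) (st : AlgState U d) : Prop :=
  (st.gram inp.user + newLocGram P inp st).det > (1 + P.αc) * (st.gram inp.user).det ∨
    inp.coin < 3 * Real.log t / t

/-- The width `√((1 + log(1 + n)) / (1 + n))` used by the server's heterogeneity test. -/
def testWidth (n : ℕ) : ℝ := Real.sqrt ((1 + Real.log (1 + n)) / (1 + n))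

/-- The state after a round without communication. -/
def localStep (P : Params m d) (inp : RoundInput U m d) (st : AlgState U d) : AlgState U d :=
  { st with
    locGram := Function.update st.locGram inp.user (newLocGram P inp st)
    locVec := Function.update st.locVec inp.user (newLocVec P inp st)
    locCount := Function.update st.locCount inp.user (newLocCount P inp st) }

/-- The state after a round with communication: the agent uploads its local data, the server
aggregates what it stores for the agents of the current connected component of the agent and sends
the result back, the local data are reset, and the edges at the agent that fail the heterogeneity
test are deleted. -/
def commStep (P : Params m d) (inp : RoundInput U m d) (st : AlgState U d) : AlgState U d :=
  let u := inp.user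
  let serGram := Function.update st.serGram u (st.serGram u + newLocGram P inp st)
  let serVec := Function.update st.serVec u (st.serVec u + newLocVec P inp st)
  let serCount := Function.update st.serCount u (st.serCount u + newLocCount P inp st)
  let serEst : U → Fin d → ℝ := fun v => (P.lam • 1 + serGram v)⁻¹ *ᵥ serVec v
  let V := component st.graph u
  let cluGram : Matrix (Fin d) (Fin d) ℝ := P.lam • 1 + ∑ v ∈ V, serGram v
  let cluVec : Fin d → ℝ := ∑ v ∈ V, serVec v
  { gram := Function.update st.gram u cluGram
    est := Function.update st.est u (cluGram⁻¹ *ᵥ cluVec)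
    locGram := Function.update st.locGram u 0
    locVec := Function.update st.locVec u 0
    locCount := Function.update st.locCount u 0
    serGram := serGram
    serVec := serVec
    serCount := serCount
    graph := st.graph.deleteEdges {e | ∃ v, v ≠ u ∧ e = s(u, v) ∧
      l2norm (serEst u - serEst v) >
        P.αd * (testWidth (serCount u) + testWidth (serCount v))} }

/-- One round `t` of the algorithm. -/
def step (P : Params m d) (t : ℕ) (inp : RoundInput U m d) (st : AlgState U d) : AlgState U d :=
  open Classical in if Communicates P t inp st then commStep P inp st else localStep P inp st

/-- The state at the beginning of round `t`, the rounds being `1, 2, 3, …`. -/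
def stateAt (P : Params m d) (inp : ℕ → RoundInput U m d) : ℕ → AlgState U d
  | 0 => initState
  | 1 => initState
  | t + 2 => step P (t + 1) (inp (t + 1)) (stateAt P inp (t + 1))

/-- In round `s` agent `v` communicates with the server. -/
def AgentComm (P : Params m d) (inp : ℕ → RoundInput U m d) (v : U) (s : ℕ) : Prop :=
  (inp s).user = v ∧ Communicates P s (inp s) (stateAt P inp s)

/-- `N_v(t)`: the last round among `1, …, t` in which agent `v` communicated with the server,
and `0` if there is none. -/
def lastComm (P : Params m d) (inp : ℕ → RoundInput U m d) (v : U) (t : ℕ) : ℕ :=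
  open Classical in ((Finset.Icc 1 t).filter fun s => AgentComm P inp v s).sup id

/-- The data behind the Gram matrix of agent `u` in round `t` come from correct clusters. Let `r` be
the last communication round of `u` before round `t`. Then every agent `v` of the true cluster of
`u` that has been active by round `r` (in particular `u` itself, if `r ≥ 1`) has communicated by
round `r`, and in its last communication round up to `r` the server's component of `v` was the
true cluster. -/
def ClusterCorrect {J : ℕ} (cl : U → Fin J) (P : Params m d) (inp : ℕ → RoundInput U m d)
    (u : U) (t : ℕ) : Prop :=
  ∀ v, cl v = cl u → (∃ s ∈ Finset.Icc 1 (lastComm P inp u (t - 1)), (inp s).user = v) →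
    1 ≤ lastComm P inp v (lastComm P inp u (t - 1)) ∧
      component (stateAt P inp (lastComm P inp v (lastComm P inp u (t - 1)))).graph v
        = Finset.univ.filter fun v' => cl v' = cl u

/-! ### The random environment -/

/-- The bandit environment over `T` rounds: `cl u` is the true cluster of user `u`, `θ j` the
preference vector of cluster `j`, and `inp t ω` the random input of round `t`. The σ-algebra `ℱ t`
is the history up to the moment in round `t` when user and contexts have been revealed and the
feedback has not. Users, contexts and feasible sets may depend on the past in any way. -/
structure IsEnvironment {Ω : Type*} [MeasurableSpace Ω] (μ : Measure Ω) {J : ℕ}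
    (K T : ℕ) (cl : U → Fin J) (θ : Fin J → Fin d → ℝ)
    (inp : ℕ → Ω → RoundInput U m d) (ℱ : Filtration ℕ ‹MeasurableSpace Ω›) : Prop where
  /-- distinct clusters have distinct preference vectors -/
  theta_injective : Function.Injective θ
  theta_norm : ∀ j, l2norm (θ j) ≤ 1
  x_norm : ∀ t ∈ Finset.Icc 1 T, ∀ ω, ∀ i ∈ (inp t ω).avail, l2norm ((inp t ω).x i) ≤ 1
  /-- there is a feasible action; feasible actions consist of at least one and at most `K` distinct
  available items -/
  feas_nonempty : ∀ t ∈ Finset.Icc 1 T, ∀ ω, (inp t ω).feas.Nonempty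
  feas_spec : ∀ t ∈ Finset.Icc 1 T, ∀ ω, ∀ a ∈ (inp t ω).feas,
    a ≠ [] ∧ a.Nodup ∧ a.length ≤ K ∧ ∀ i ∈ a, i ∈ (inp t ω).avail
  user_meas : ∀ t ∈ Finset.Icc 1 T, ∀ v, MeasurableSet[ℱ t] {ω | (inp t ω).user = v}
  avail_meas : ∀ t ∈ Finset.Icc 1 T, ∀ S, MeasurableSet[ℱ t] {ω | (inp t ω).avail = S}
  feas_meas : ∀ t ∈ Finset.Icc 1 T, ∀ A, MeasurableSet[ℱ t] {ω | (inp t ω).feas = A}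
  x_meas : ∀ t ∈ Finset.Icc 1 T, ∀ i k, Measurable[ℱ t] fun ω => (inp t ω).x i k
  w_meas : ∀ t ∈ Finset.Icc 1 T, ∀ i, MeasurableSet[ℱ (t + 1)] {ω | (inp t ω).w i = true}
  coin_meas : ∀ t ∈ Finset.Icc 1 T, Measurable[ℱ (t + 1)] fun ω => (inp t ω).coin
  /-- the coin is uniform on `[0, 1]`, independent of the past and of the current feedback -/
  coin_law : ∀ t ∈ Finset.Icc 1 T,
    μ.map (fun ω => (inp t ω).coin) = volume.restrict (Set.Icc (0 : ℝ) 1)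
  coin_indep : ∀ t ∈ Finset.Icc 1 T,
    Indep (MeasurableSpace.comap (fun ω => (inp t ω).coin) inferInstance)
      (ℱ t ⊔ MeasurableSpace.comap (fun ω => (inp t ω).w) ⊤) μ
  /-- given the history, the clicks on the available items are independent Bernoulli variables, and
  the click on item `i` has mean `⟨θ, x i⟩`, with `θ` the preference vector of the user. (For
  variables with values in `{0, 1}`, the product formula over all sets of items is the same as
  conditional independence together with the formula for the conditional means.) -/
  feedback : ∀ t ∈ Finset.Icc 1 T, ∀ S : Finset (Fin m), ∀ᵐ ω ∂μ, S ⊆ (inp t ω).avail →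
    (μ[fun ω' => ∏ i ∈ S, (if (inp t ω').w i then (1 : ℝ) else 0) | ℱ t]) ω
      = ∏ i ∈ S, (θ (cl (inp t ω).user) ⬝ᵥ (inp t ω).x i)

end FedC3B

end

/-!
The estimate of an agent is a ridge regression on the data that the agents of its cluster have
uploaded. Its error is controlled by the noise in these data, and the uploaded noise is the noise
collected by the whole cluster minus the noise that its agents have not uploaded yet. The uploaded
noise itself is not a martingale, because the upload times depend on the feedback, but for fixed
rounds `s < r` the noise of a fixed set of users in the rounds `s + 1, …, r` is one (in `r`).

*Self-normalized bound.* For the noise `S` and the Gram matrix `V = ρ I + ∑ x xᵀ` of such a block of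
rounds, the potential `exp (2 ‖S‖²_{V⁻¹}) / √(det V)` is a supermartingale. By the Sherman–Morrison
formula and the matrix determinant lemma, adding one observation reduces this to an inequality
between real numbers (`bernoulli_mixture_le`, `potential_bernoulli_step`), which is Hoeffding's
lemma integrated against a Gaussian on the real line. Inside a round the user stops at the first
click; an induction on the list of items conditions on the event that the items checked so far have
not been clicked (`setLIntegral_potential_observed_le`). Markov's inequality and
`det V ≤ (tr V / d) ^ d` then bound `‖S‖²_{V⁻¹}` by a quarter of the quantity under the root in the
confidence radius, except with probability `δ / (T |U|)²`
(`IsEnvironment.measure_noise_gt_le`). At most `T² |U|` blocks are needed: for each end `r` and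
each user, the user alone from any earlier round on, and the cluster of the user from the start.

*Comparison of Gram matrices.* As long as an agent does not communicate, its Gram matrix `A` and its
local data `B` satisfy `det (A + B) ≤ (1 + αc) det A`, which forces `B ≤ αc A`
(`quadForm_le_of_det_le`). If the clusters are correct, `A` is dominated by the Gram matrix of the
agent `u` under consideration, since it aggregates older data of the same cluster. So the data
missing at `u` are small compared with its own Gram matrix, and the noise bounds, with regularizer
`ρ = αc λ`, transfer to the norm of that matrix (`matNorm_est_sub_le`).
-/

noncomputable section

namespace FedC3B

open MeasureTheory ProbabilityTheory Matrix

set_option linter.unusedSectionVars false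

/-! ### Positive definite matrices -/

section LinearAlgebra
variable {n : Type*} [Fintype n]

lemma quadForm_nonneg {B : Matrix n n ℝ} (hB : B.PosSemidef) (x : n → ℝ) :
    0 ≤ x ⬝ᵥ (B *ᵥ x) := by
  simpa using hB.dotProduct_mulVec_nonneg x

lemma quadForm_comm {B : Matrix n n ℝ} (hB : B.IsHermitian) (x y : n → ℝ) :
    x ⬝ᵥ (B *ᵥ y) = y ⬝ᵥ (B *ᵥ x) := by
  have hT : Bᵀ = B := by rw [← conjTranspose_eq_transpose_of_trivial, hB.eq]
  rw [dotProduct_mulVec, dotProduct_comm, ← mulVec_transpose, hT]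

/-- The Cauchy–Schwarz inequality for a positive semi-definite form. -/
lemma quadForm_cauchy_schwarz {B : Matrix n n ℝ} (hB : B.PosSemidef) (x y : n → ℝ) :
    (x ⬝ᵥ (B *ᵥ y)) ^ 2 ≤ (x ⬝ᵥ (B *ᵥ x)) * (y ⬝ᵥ (B *ᵥ y)) := by
  have h : ∀ t : ℝ, 0 ≤ (y ⬝ᵥ (B *ᵥ y)) * (t * t) + (2 * (x ⬝ᵥ (B *ᵥ y))) * t
      + x ⬝ᵥ (B *ᵥ x) := by
    intro t
    have := quadForm_nonneg hB (x + t • y)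
    simp only [mulVec_add, mulVec_smul, add_dotProduct, dotProduct_add, smul_dotProduct,
      dotProduct_smul, smul_eq_mul, quadForm_comm hB.1 y x] at this
    linarith
  have := discrim_le_zero h
  unfold discrim at this
  nlinarith

lemma posSemidef_vecMulVec_self (v : n → ℝ) : (vecMulVec v v).PosSemidef := by
  simpa using posSemidef_vecMulVec_self_star v

variable [DecidableEq n]

lemma isUnit_det_of_posDef {V : Matrix n n ℝ} (hV : V.PosDef) : IsUnit V.det :=
  (isUnit_iff_isUnit_det V).1 hV.isUnit

/-- The Cauchy–Schwarz inequality for the dual norms `‖·‖_V` and `‖·‖_{V⁻¹}`. -/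
lemma dotProduct_sq_le {V : Matrix n n ℝ} (hV : V.PosDef) (e s : n → ℝ) :
    (e ⬝ᵥ s) ^ 2 ≤ (s ⬝ᵥ (V⁻¹ *ᵥ s)) * (e ⬝ᵥ (V *ᵥ e)) := by
  have hu := isUnit_det_of_posDef hV
  have hs : V *ᵥ (V⁻¹ *ᵥ s) = s := by
    rw [mulVec_mulVec, mul_nonsing_inv _ hu, one_mulVec]
  have := quadForm_cauchy_schwarz hV.posSemidef e (V⁻¹ *ᵥ s)
  rw [hs, dotProduct_comm (V⁻¹ *ᵥ s) s] at this
  linarith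

lemma det_add_vecMulVec_self {V : Matrix n n ℝ} (hV : V.PosDef) (x : n → ℝ) :
    (V + vecMulVec x x).det = V.det * (1 + x ⬝ᵥ (V⁻¹ *ᵥ x)) := by
  rw [vecMulVec_eq Unit, det_add_replicateCol_mul_replicateRow (isUnit_det_of_posDef hV),
    det_unique (n := Unit), ← replicateRow_vecMul, dotProduct_mulVec]
  simp [mul_apply, dotProduct]

/-- The Sherman–Morrison formula, for the quadratic form of the inverse. -/
lemma quadForm_inv_add_vecMulVec {V : Matrix n n ℝ} (hV : V.PosDef) (x z : n → ℝ) :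
    z ⬝ᵥ ((V + vecMulVec x x)⁻¹ *ᵥ z)
      = z ⬝ᵥ (V⁻¹ *ᵥ z) - (x ⬝ᵥ (V⁻¹ *ᵥ z)) ^ 2 / (1 + x ⬝ᵥ (V⁻¹ *ᵥ x)) := by
  have hq : 0 ≤ x ⬝ᵥ (V⁻¹ *ᵥ x) := quadForm_nonneg hV.inv.posSemidef x
  have hV' : (V + vecMulVec x x).PosDef := hV.add_posSemidef (posSemidef_vecMulVec_self x)
  have hVV : ∀ y, V *ᵥ (V⁻¹ *ᵥ y) = y := fun y => by
    rw [mulVec_mulVec, mul_nonsing_inv _ (isUnit_det_of_posDef hV), one_mulVec]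
  have key : (V + vecMulVec x x) *ᵥ (V⁻¹ *ᵥ z
      - ((x ⬝ᵥ (V⁻¹ *ᵥ z)) / (1 + x ⬝ᵥ (V⁻¹ *ᵥ x))) • (V⁻¹ *ᵥ x)) = z := by
    rw [add_mulVec, mulVec_sub, mulVec_smul, hVV, hVV, vecMulVec_mulVec, dotProduct_sub,
      dotProduct_smul]
    ext i
    simp
    field_simp
    ring
  have hinv : (V + vecMulVec x x)⁻¹ *ᵥ z = V⁻¹ *ᵥ z
      - ((x ⬝ᵥ (V⁻¹ *ᵥ z)) / (1 + x ⬝ᵥ (V⁻¹ *ᵥ x))) • (V⁻¹ *ᵥ x) := by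
    conv_lhs => rw [← key]
    rw [mulVec_mulVec, nonsing_inv_mul _ (isUnit_det_of_posDef hV'), one_mulVec]
  rw [hinv, dotProduct_sub, dotProduct_smul, quadForm_comm hV.inv.1 z x, smul_eq_mul]
  ring

/-- The determinant is monotone: a positive semi-definite matrix is a sum of matrices `v vᵀ`, and
adding such a matrix multiplies the determinant by `1 + vᵀ A⁻¹ v ≥ 1`. -/
lemma det_le_det_add {A B : Matrix n n ℝ} (hA : A.PosDef) (hB : B.PosSemidef) :
    A.det ≤ (A + B).det := by
  obtain ⟨L, rfl⟩ : ∃ L : Matrix n n ℝ, B = Lᴴ * L := by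
    open scoped MatrixOrder in
    obtain ⟨L, hL⟩ := CStarAlgebra.nonneg_iff_eq_star_mul_self.1 hB.nonneg
    exact ⟨L, hL⟩
  have hsum : Lᴴ * L = ∑ k, vecMulVec (L k) (L k) := by
    ext i j
    simp [mul_apply, Matrix.sum_apply, vecMulVec_apply]
  rw [hsum]
  have : ∀ s : Finset n, (A + ∑ k ∈ s, vecMulVec (L k) (L k)).PosDef ∧
      A.det ≤ (A + ∑ k ∈ s, vecMulVec (L k) (L k)).det := by
    intro s
    induction s using Finset.induction_on with
    | empty => simpa using hA
    | insert k s hk ih =>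
      rw [Finset.sum_insert hk, add_comm (vecMulVec _ _), ← add_assoc]
      refine ⟨ih.1.add_posSemidef (posSemidef_vecMulVec_self _), ?_⟩
      rw [det_add_vecMulVec_self ih.1]
      have := quadForm_nonneg ih.1.inv.posSemidef (L k)
      have h2 := ih.1.det_pos
      nlinarith [ih.2]
  exact (this Finset.univ).2

/-- If adding `B` multiplies the determinant of `A` by at most `1 + α`, then `B ≤ α A`. For a
vector `z`, the matrix `B` dominates `v vᵀ` with `v = B z / √(zᵀ B z)`, so that
`vᵀ A⁻¹ v ≤ α`, and `zᵀ B z = (zᵀ v)²`. -/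
lemma quadForm_le_of_det_le {A B : Matrix n n ℝ} {α : ℝ} (hA : A.PosDef) (hB : B.PosSemidef)
    (h : (A + B).det ≤ (1 + α) * A.det) (z : n → ℝ) :
    z ⬝ᵥ (B *ᵥ z) ≤ α * (z ⬝ᵥ (A *ᵥ z)) := by
  have hα : 0 ≤ α := by
    have := det_le_det_add hA hB
    have := hA.det_pos
    nlinarith
  have hAz := quadForm_nonneg hA.posSemidef z
  rcases (quadForm_nonneg hB z).eq_or_lt with h0 | h0
  · rw [← h0]; positivity
  set b := z ⬝ᵥ (B *ᵥ z) with hb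
  set v : n → ℝ := (√b)⁻¹ • (B *ᵥ z) with hv
  have hsq : √b * √b = b := Real.mul_self_sqrt h0.le
  have hsp : 0 < √b := Real.sqrt_pos.2 h0
  have hC : (B - vecMulVec v v).PosSemidef := by
    refine PosSemidef.of_dotProduct_mulVec_nonneg
      (hB.1.sub (posSemidef_vecMulVec_self v).1) fun y => ?_
    have hcs := quadForm_cauchy_schwarz hB y z
    simp only [star_trivial, sub_mulVec, vecMulVec_mulVec, dotProduct_sub, hv]
    simp only [smul_dotProduct, smul_eq_mul, op_smul_eq_smul, dotProduct_smul,
      dotProduct_comm (B *ᵥ z) y]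
    rw [sub_nonneg]
    calc _ = (y ⬝ᵥ (B *ᵥ z)) ^ 2 / (√b * √b) := by field_simp
      _ ≤ _ := by rw [hsq, div_le_iff₀ h0]; exact hcs
  have h1 : A.det * (1 + v ⬝ᵥ (A⁻¹ *ᵥ v)) ≤ (1 + α) * A.det := by
    rw [← det_add_vecMulVec_self hA]
    refine le_trans ?_ h
    have := det_le_det_add (hA.add_posSemidef (posSemidef_vecMulVec_self v)) hC
    rwa [add_assoc, add_sub_cancel] at this
  have h2 : v ⬝ᵥ (A⁻¹ *ᵥ v) ≤ α := by
    have := hA.det_pos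
    nlinarith
  have h3 := dotProduct_sq_le hA z v
  have h4 : (z ⬝ᵥ v) ^ 2 = b := by
    simp only [hv, dotProduct_smul, smul_eq_mul, ← hb]
    nth_rewrite 2 [← hsq]
    field_simp
    nlinarith
  rw [h4] at h3
  exact h3.trans (mul_le_mul_of_nonneg_right h2 hAz)

/-- The arithmetic-geometric mean inequality for the eigenvalues. -/
lemma det_le_trace_div_pow [Nonempty n] {V : Matrix n n ℝ} (hV : V.PosSemidef) :
    V.det ≤ (V.trace / Fintype.card n) ^ Fintype.card n := by
  have hc : (0 : ℝ) < Fintype.card n := by exact_mod_cast Fintype.card_pos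
  have h := Real.geom_mean_le_arith_mean Finset.univ (fun _ => (1 : ℝ)) hV.1.eigenvalues
    (fun _ _ => zero_le_one) (by simpa using hc) (fun i _ => hV.eigenvalues_nonneg i)
  have hdet : V.det = ∏ i, hV.1.eigenvalues i := by simpa using hV.1.det_eq_prod_eigenvalues
  have htr : V.trace = ∑ i, hV.1.eigenvalues i := by simpa using hV.1.trace_eq_sum_eigenvalues
  simp only [Real.rpow_one, ← hdet, one_mul, ← htr, Finset.sum_const, Finset.card_univ,
    nsmul_eq_mul, mul_one] at h
  have h2 := pow_le_pow_left₀ (Real.rpow_nonneg hV.det_nonneg _) h (Fintype.card n)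
  rwa [← Real.rpow_mul_natCast hV.det_nonneg, inv_mul_cancel₀ hc.ne', Real.rpow_one] at h2
end LinearAlgebra

/-! ### The self-normalized potential -/

/-- Hoeffding's lemma for a centred Bernoulli variable, scaled by `2`. -/
lemma bernoulli_mgf_le {p : ℝ} (h0 : 0 ≤ p) (h1 : p ≤ 1) (y : ℝ) :
    p * Real.exp (y * (2 * (1 - p))) + (1 - p) * Real.exp (y * (-(2 * p)))
      ≤ Real.exp (y ^ 2 / 2) := by
  set μ : Measure ℝ := ENNReal.ofReal p • Measure.dirac (2 * (1 - p))
    + ENNReal.ofReal (1 - p) • Measure.dirac (-(2 * p)) with hμ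
  have : IsProbabilityMeasure μ := ⟨by
    simp [hμ, ← ENNReal.ofReal_add h0 (sub_nonneg.2 h1)]⟩
  have hint : ∀ f : ℝ → ℝ, ∫ x, f x ∂μ = p * f (2 * (1 - p)) + (1 - p) * f (-(2 * p)) := by
    intro f
    rw [hμ, integral_add_measure, integral_smul_measure, integral_smul_measure]
    · simp [h0, sub_nonneg.2 h1]
    all_goals exact (integrable_dirac (by simp)).smul_measure (by simp)
  have hs := hasSubgaussianMGF_of_mem_Icc_of_integral_eq_zero (μ := μ) (X := id)
    (a := -(2 * p)) (b := 2 * (1 - p)) aemeasurable_id ?_ ?_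
  · have h := hs.mgf_le y
    rw [mgf, hint] at h
    refine h.trans (le_of_eq ?_)
    congr 1
    have : (2 * (1 - p) - -(2 * p)) = 2 := by ring
    rw [this]
    simp
  · rw [hμ, ae_add_measure_iff]
    constructor
    all_goals
      refine Measure.ae_smul_measure ?_ _
      rw [ae_dirac_eq]
      simp
      linarith
  · rw [hint]; simp; ring


lemma integral_exp_mul_exp_neg_mul_sq (c m r : ℝ) :
    ∫ y : ℝ, Real.exp c * Real.exp (-r * (y - m) ^ 2) = Real.exp c * √(Real.pi / r) := by
  rw [integral_const_mul, integral_sub_right_eq_self (fun y => Real.exp (-r * y ^ 2)) m,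
    integral_gaussian]

/-- One step of the self-normalized bound in dimension one. It is Hoeffding's lemma in the form
`E exp (y η - y² / 2) ≤ 1`, with `η` a centred Bernoulli variable scaled by `2`, integrated over
`y` against a Gaussian density of mean `s` and variance `q`. -/
lemma bernoulli_mixture_le {p q : ℝ} (h0 : 0 ≤ p) (h1 : p ≤ 1) (hq : 0 ≤ q) (s : ℝ) :
    let E : ℝ → ℝ := fun h => Real.exp ((2 * h * s + h ^ 2 * q - s ^ 2) / (2 * (1 + q)))
    p * E (2 * (1 - p)) + (1 - p) * E (-(2 * p)) ≤ √(1 + q) := by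
  intro E
  rcases hq.eq_or_lt with rfl | hq
  · have h := bernoulli_mgf_le h0 h1 s
    have hE : ∀ h, E h = Real.exp (s * h) * (Real.exp (s ^ 2 / 2))⁻¹ := by
      intro h
      rw [← Real.exp_neg, ← Real.exp_add]
      simp only [E]
      congr 1
      ring
    rw [hE, hE, ← mul_assoc p, ← mul_assoc (1 - p), ← add_mul, add_zero, Real.sqrt_one,
      mul_inv_le_iff₀ (Real.exp_pos _), one_mul]
    exact h
  set r : ℝ := (1 + q) / (2 * q) with hr
  have hrp : 0 < r := by positivity
  set g : ℝ → ℝ → ℝ := fun h y => E h * Real.exp (-r * (y - (h * q + s) / (1 + q)) ^ 2) with hg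
  have hgi : ∀ h, Integrable (g h) := fun h =>
    ((integrable_exp_neg_mul_sq hrp).comp_sub_right _).const_mul _
  have hgI : ∀ h, ∫ y, g h y = E h * √(Real.pi / r) := fun h =>
    integral_exp_mul_exp_neg_mul_sq _ _ _
  have hge : ∀ h y, g h y
      = Real.exp (y * h) * (Real.exp (-(y ^ 2 / 2)) * Real.exp (-(1 / (2 * q)) * (y - s) ^ 2)) := by
    intro h y
    simp only [hg, E, hr, ← Real.exp_add]
    congr 1
    field_simp
    ring
  have hle : ∀ y, p * g (2 * (1 - p)) y + (1 - p) * g (-(2 * p)) y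
      ≤ Real.exp 0 * Real.exp (-(1 / (2 * q)) * (y - s) ^ 2) := by
    intro y
    rw [hge, hge, ← mul_assoc p, ← mul_assoc (1 - p), ← add_mul, ← mul_assoc]
    refine mul_le_mul_of_nonneg_right ?_ (Real.exp_pos _).le
    rw [Real.exp_neg (y ^ 2 / 2), Real.exp_zero, mul_inv_le_iff₀ (Real.exp_pos _), one_mul]
    exact bernoulli_mgf_le h0 h1 y
  have hI := integral_mono (((hgi _).const_mul p).add ((hgi _).const_mul (1 - p)))
    (((integrable_exp_neg_mul_sq (b := 1 / (2 * q)) (by positivity)).comp_sub_right s).const_mul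
      (Real.exp 0)) hle
  have hI1 : ∫ y, ((fun y => p * g (2 * (1 - p)) y) + fun y => (1 - p) * g (-(2 * p)) y) y
      = (p * E (2 * (1 - p)) + (1 - p) * E (-(2 * p))) * √(Real.pi / r) := by
    rw [integral_add' ((hgi _).const_mul p) ((hgi _).const_mul (1 - p)), integral_const_mul p,
      integral_const_mul (1 - p), hgI, hgI]
    ring
  rw [hI1, integral_exp_mul_exp_neg_mul_sq, Real.exp_zero, one_mul] at hI
  have hpos : 0 < √(Real.pi / r) := Real.sqrt_pos.2 (by positivity)
  refine le_of_mul_le_mul_right (hI.trans (le_of_eq ?_)) hpos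
  rw [← Real.sqrt_mul (by positivity)]
  congr 1
  rw [hr]
  field_simp

/-- The potential of the self-normalized bound: `exp (2 ‖S‖²_{V⁻¹}) / √(det V)`. -/
def potential {d : ℕ} (S : Fin d → ℝ) (V : Matrix (Fin d) (Fin d) ℝ) : ℝ :=
  Real.exp (2 * (S ⬝ᵥ (V⁻¹ *ᵥ S))) / √V.det

/-- The potential does not increase in mean when `S` is increased by `(w - p) x`, with `w` a
Bernoulli variable of mean `p`, and `V` by `x xᵀ`. -/
lemma potential_bernoulli_step {d : ℕ} {V : Matrix (Fin d) (Fin d) ℝ} (hV : V.PosDef)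
    {p : ℝ} (h0 : 0 ≤ p) (h1 : p ≤ 1) (S x : Fin d → ℝ) :
    p * potential (S + (1 - p) • x) (V + vecMulVec x x)
      + (1 - p) * potential (S + (0 - p) • x) (V + vecMulVec x x) ≤ potential S V := by
  set q := x ⬝ᵥ (V⁻¹ *ᵥ x) with hq
  set a := x ⬝ᵥ (V⁻¹ *ᵥ S) with ha
  have hq0 : 0 ≤ q := quadForm_nonneg hV.inv.posSemidef x
  have h1q : (1 + q) ≠ 0 := by positivity
  have hd := hV.det_pos
  have key : ∀ h : ℝ, potential (S + h • x) (V + vecMulVec x x)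
      = Real.exp ((2 * (2 * h) * (2 * a) + (2 * h) ^ 2 * q - (2 * a) ^ 2) / (2 * (1 + q)))
        * (potential S V * (√(1 + q))⁻¹) := by
    intro h
    have hS : S ⬝ᵥ (V⁻¹ *ᵥ x) = a := quadForm_comm hV.inv.1 _ _
    have e1 : 2 * ((S + h • x) ⬝ᵥ ((V + vecMulVec x x)⁻¹ *ᵥ (S + h • x)))
        = (2 * (2 * h) * (2 * a) + (2 * h) ^ 2 * q - (2 * a) ^ 2) / (2 * (1 + q))
          + 2 * (S ⬝ᵥ (V⁻¹ *ᵥ S)) := by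
      rw [quadForm_inv_add_vecMulVec hV]
      simp only [mulVec_add, mulVec_smul, add_dotProduct, dotProduct_add, smul_dotProduct,
        dotProduct_smul, smul_eq_mul, hS, ← ha, ← hq]
      field_simp
      ring
    rw [potential, potential, e1, det_add_vecMulVec_self hV, Real.sqrt_mul hd.le, Real.exp_add]
    rw [← hq]
    field_simp
  rw [key, key, ← mul_assoc p, ← mul_assoc (1 - p), ← add_mul]
  have hm := bernoulli_mixture_le h0 h1 hq0 (2 * a)
  have hpos : 0 < √(1 + q) := Real.sqrt_pos.2 (by positivity)
  have hφ : 0 ≤ potential S V := by unfold potential; positivity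
  calc _ ≤ √(1 + q) * (potential S V * (√(1 + q))⁻¹) := by
        refine mul_le_mul_of_nonneg_right (le_trans (le_of_eq ?_) hm) (by positivity)
        simp only [mul_neg, zero_sub]
    _ = _ := by field_simp

/-! ### Measurability of matrices -/

/-- Matrices carry the product σ-algebra of their entries. -/
instance instMeasurableSpaceMatrix {d : ℕ} : MeasurableSpace (Matrix (Fin d) (Fin d) ℝ) :=
  inferInstanceAs (MeasurableSpace (Fin d → Fin d → ℝ))

instance instBorelSpaceMatrix {d : ℕ} : BorelSpace (Matrix (Fin d) (Fin d) ℝ) :=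
  inferInstanceAs (BorelSpace (Fin d → Fin d → ℝ))

instance instSecondCountableMatrix {d : ℕ} : SecondCountableTopology (Matrix (Fin d) (Fin d) ℝ) :=
  inferInstanceAs (SecondCountableTopology (Fin d → Fin d → ℝ))

section Measurability
variable {Ω : Type*} {_ : MeasurableSpace Ω} {d : ℕ}

lemma measurable_matrix_det : Measurable (det : Matrix (Fin d) (Fin d) ℝ → ℝ) :=
  (Continuous.matrix_det continuous_id).measurable

lemma measurable_matrix_inv :
    Measurable (fun M : Matrix (Fin d) (Fin d) ℝ => M⁻¹) := by
  have h : (fun M : Matrix (Fin d) (Fin d) ℝ => M⁻¹) = fun M => (M.det)⁻¹ • M.adjugate := by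
    funext M
    rw [inv_def, Ring.inverse_eq_inv']
  rw [h]
  exact measurable_matrix_det.inv.smul (Continuous.matrix_adjugate continuous_id).measurable

lemma measurable_mulVec {M : Ω → Matrix (Fin d) (Fin d) ℝ} {v : Ω → Fin d → ℝ}
    (hM : Measurable M) (hv : Measurable v) : Measurable fun ω => M ω *ᵥ v ω :=
  (Continuous.matrix_mulVec continuous_fst continuous_snd :
    Continuous fun z : Matrix (Fin d) (Fin d) ℝ × (Fin d → ℝ) => z.1 *ᵥ z.2).measurable.comp
    (hM.prodMk hv)

lemma measurable_dotProduct {u v : Ω → Fin d → ℝ}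
    (hu : Measurable u) (hv : Measurable v) : Measurable fun ω => u ω ⬝ᵥ v ω :=
  (Continuous.dotProduct continuous_fst continuous_snd :
    Continuous fun z : (Fin d → ℝ) × (Fin d → ℝ) => z.1 ⬝ᵥ z.2).measurable.comp
    (hu.prodMk hv)

lemma measurable_vecMulVec {u v : Ω → Fin d → ℝ}
    (hu : Measurable u) (hv : Measurable v) : Measurable fun ω => vecMulVec (u ω) (v ω) :=
  (Continuous.matrix_vecMulVec continuous_fst continuous_snd :
    Continuous fun z : (Fin d → ℝ) × (Fin d → ℝ) => vecMulVec z.1 z.2).measurable.comp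
    (hu.prodMk hv)

lemma measurable_potential {S : Ω → Fin d → ℝ} {V : Ω → Matrix (Fin d) (Fin d) ℝ}
    (hS : Measurable S) (hV : Measurable V) : Measurable fun ω => potential (S ω) (V ω) :=
  (Real.measurable_exp.comp ((measurable_dotProduct hS
    (measurable_mulVec (measurable_matrix_inv.comp hV) hS)).const_mul 2)).div
    (measurable_matrix_det.comp hV).sqrt

lemma measurable_add_sub_smul {S v : Ω → Fin d → ℝ} {a : Ω → ℝ} (hS : Measurable S)
    (ha : Measurable a) (hv : Measurable v) (c : ℝ) :
    Measurable fun ω => S ω + (c - a ω) • v ω :=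
  hS.add ((ha.const_sub c).smul hv)

end Measurability

/-! ### One round of feedback -/

section Round
variable {Ω : Type*} {𝓕 m0 : MeasurableSpace Ω} {μ : Measure Ω} [IsProbabilityMeasure μ]

/-- Pulling out a nonnegative factor that is known, without any integrability of this factor: on the
smaller σ-algebra, `f` and its conditional expectation are densities of the same measure. -/
lemma lintegral_mul_condExp (h𝓕 : 𝓕 ≤ m0) {f : Ω → ℝ} (hfm : Measurable f) (hf0 : 0 ≤ f)
    (hfi : Integrable f μ) {g : Ω → ENNReal} (hg : Measurable[𝓕] g) :
    ∫⁻ ω, ENNReal.ofReal (f ω) * g ω ∂μ = ∫⁻ ω, ENNReal.ofReal ((μ[f|𝓕]) ω) * g ω ∂μ := by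
  have hcm : Measurable (μ[f|𝓕]) := (stronglyMeasurable_condExp.mono h𝓕).measurable
  have hν : (μ.withDensity fun ω => ENNReal.ofReal (f ω)).trim h𝓕
      = (μ.withDensity fun ω => ENNReal.ofReal ((μ[f|𝓕]) ω)).trim h𝓕 := by
    refine @Measure.ext _ 𝓕 _ _ fun A hA => ?_
    rw [trim_measurableSet_eq _ hA, trim_measurableSet_eq _ hA, withDensity_apply _ (h𝓕 A hA),
      withDensity_apply _ (h𝓕 A hA),
      ← ofReal_integral_eq_lintegral_ofReal hfi.integrableOn (ae_of_all _ hf0),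
      ← ofReal_integral_eq_lintegral_ofReal integrable_condExp.integrableOn
        (ae_restrict_of_ae (condExp_nonneg (ae_of_all _ hf0))), setIntegral_condExp h𝓕 hfi hA]
  have h1 := lintegral_withDensity_eq_lintegral_mul μ hfm.ennreal_ofReal (hg.mono h𝓕 le_rfl)
  have h2 := lintegral_withDensity_eq_lintegral_mul μ hcm.ennreal_ofReal (hg.mono h𝓕 le_rfl)
  simp only [Pi.mul_apply] at h1 h2
  rw [← h1, ← h2, ← lintegral_trim h𝓕 hg, ← lintegral_trim h𝓕 hg, hν]

variable {m : ℕ} {w : Ω → Fin m → Bool} {p : Ω → Fin m → ℝ} {av : Ω → Finset (Fin m)}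

/-- A click as a real number. -/
def click (b : Bool) : ℝ := if b then 1 else 0

lemma click_nonneg (b : Bool) : 0 ≤ click b := by cases b <;> simp [click]

lemma click_le_one (b : Bool) : click b ≤ 1 := by cases b <;> simp [click]

lemma measurable_click (hw : ∀ i, MeasurableSet {ω | w ω i = true}) (i : Fin m) :
    Measurable fun ω => click (w ω i) :=
  Measurable.ite (hw i) measurable_const measurable_const

/-- The indicator that the items of `A` are clicked and those of `B` are not. -/
def pattern (w : Fin m → Bool) (A B : Finset (Fin m)) : ℝ :=
  (∏ i ∈ A, click (w i)) * ∏ i ∈ B, (1 - click (w i))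

lemma pattern_nonneg (w : Fin m → Bool) (A B : Finset (Fin m)) : 0 ≤ pattern w A B :=
  mul_nonneg (Finset.prod_nonneg fun _ _ => click_nonneg _)
    (Finset.prod_nonneg fun _ _ => sub_nonneg.2 (click_le_one _))

lemma pattern_le_one (w : Fin m → Bool) (A B : Finset (Fin m)) : pattern w A B ≤ 1 :=
  mul_le_one₀ (Finset.prod_le_one (fun _ _ => click_nonneg _) fun _ _ => click_le_one _)
    (Finset.prod_nonneg fun _ _ => sub_nonneg.2 (click_le_one _))
    (Finset.prod_le_one (fun _ _ => sub_nonneg.2 (click_le_one _))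
      fun _ _ => by linarith [click_nonneg (w ‹_›)])

lemma measurable_pattern (hw : ∀ i, MeasurableSet {ω | w ω i = true}) (A B : Finset (Fin m)) :
    Measurable fun ω => pattern (w ω) A B :=
  (Finset.measurable_prod A fun i _ => measurable_click hw i).mul
    (Finset.measurable_prod B fun i _ => (measurable_click hw i).const_sub 1)

lemma integrable_pattern (hw : ∀ i, MeasurableSet {ω | w ω i = true}) (A B : Finset (Fin m)) :
    Integrable (fun ω => pattern (w ω) A B) μ :=
  Integrable.of_bound (measurable_pattern hw A B).aestronglyMeasurable 1
    (ae_of_all _ fun ω => by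
      rw [Real.norm_eq_abs, abs_of_nonneg (pattern_nonneg _ _ _)]
      exact pattern_le_one _ _ _)

/-- The conditional probability of a pattern of clicks, by inclusion–exclusion from the
probabilities that all items of a set are clicked. -/
lemma condExp_pattern (hw : ∀ i, MeasurableSet {ω | w ω i = true})
    (hfb : ∀ S : Finset (Fin m), ∀ᵐ ω ∂μ, S ⊆ av ω →
      (μ[fun ω' => ∏ i ∈ S, click (w ω' i) | 𝓕]) ω = ∏ i ∈ S, p ω i)
    (B A : Finset (Fin m)) (hAB : Disjoint A B) :
    ∀ᵐ ω ∂μ, A ∪ B ⊆ av ω → (μ[fun ω' => pattern (w ω') A B | 𝓕]) ω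
      = (∏ i ∈ A, p ω i) * ∏ i ∈ B, (1 - p ω i) := by
  induction B using Finset.induction_on generalizing A with
  | empty => simpa [pattern] using hfb A
  | insert b B hb ih =>
    rw [Finset.disjoint_insert_right] at hAB
    have hd : Disjoint (insert b A) B := Finset.disjoint_insert_left.2 ⟨hb, hAB.2⟩
    have hf : (fun ω => pattern (w ω) A (insert b B))
        = (fun ω => pattern (w ω) A B) - fun ω => pattern (w ω) (insert b A) B := by
      funext ω
      simp only [pattern, Pi.sub_apply, Finset.prod_insert hb, Finset.prod_insert hAB.1]
      ring
    rw [hf]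
    filter_upwards [ih A hAB.2, ih _ hd, condExp_sub (integrable_pattern (μ := μ) hw A B)
      (integrable_pattern hw (insert b A) B) 𝓕] with ω h1 h2 h3 hsub
    rw [h3, Pi.sub_apply, h1 (fun i hi => hsub ?_), h2 (fun i hi => hsub ?_),
      Finset.prod_insert hb, Finset.prod_insert hAB.1]
    · ring
    all_goals
      simp only [Finset.mem_union, Finset.mem_insert] at hi ⊢
      tauto

/-- Conditional means of clicks lie in the unit interval, so the inner products of features and
preference vectors need not be assumed to. -/
lemma click_mean_mem_Icc (hw : ∀ i, MeasurableSet {ω | w ω i = true})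
    (hfb : ∀ S : Finset (Fin m), ∀ᵐ ω ∂μ, S ⊆ av ω →
      (μ[fun ω' => ∏ i ∈ S, click (w ω' i) | 𝓕]) ω = ∏ i ∈ S, p ω i) (h𝓕 : 𝓕 ≤ m0) (i : Fin m) :
    ∀ᵐ ω ∂μ, i ∈ av ω → 0 ≤ p ω i ∧ p ω i ≤ 1 := by
  have hc := hfb {i}
  have hi : Integrable (fun ω => click (w ω i)) μ := by
    simpa [pattern] using integrable_pattern (μ := μ) hw {i} ∅
  have h0 : 0 ≤ᵐ[μ] μ[fun ω => click (w ω i)|𝓕] :=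
    condExp_nonneg (ae_of_all _ fun ω => click_nonneg _)
  have h1 : μ[fun ω => click (w ω i)|𝓕] ≤ᵐ[μ] μ[fun _ => (1 : ℝ)|𝓕] :=
    condExp_mono hi (integrable_const _) (ae_of_all _ fun ω => click_le_one _)
  rw [condExp_const h𝓕] at h1
  simp only [Finset.prod_singleton, Finset.singleton_subset_iff] at hc
  filter_upwards [hc, h0, h1] with ω hc h0 h1 hav
  rw [← hc hav]
  exact ⟨h0, h1⟩

lemma setLIntegral_pattern (h𝓕 : 𝓕 ≤ m0) (hw : ∀ i, MeasurableSet {ω | w ω i = true})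
    (hfb : ∀ S : Finset (Fin m), ∀ᵐ ω ∂μ, S ⊆ av ω →
      (μ[fun ω' => ∏ i ∈ S, click (w ω' i) | 𝓕]) ω = ∏ i ∈ S, p ω i)
    {A B : Finset (Fin m)} (hAB : Disjoint A B) {E : Set Ω} (hE : MeasurableSet[𝓕] E)
    (hav : ∀ ω ∈ E, A ∪ B ⊆ av ω) {g : Ω → ENNReal} (hg : Measurable[𝓕] g) :
    ∫⁻ ω in E, ENNReal.ofReal (pattern (w ω) A B) * g ω ∂μ
      = ∫⁻ ω in E, ENNReal.ofReal ((∏ i ∈ A, p ω i) * ∏ i ∈ B, (1 - p ω i)) * g ω ∂μ := by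
  have h := lintegral_mul_condExp (μ := μ) h𝓕 (measurable_pattern hw A B)
    (fun ω => pattern_nonneg _ _ _) (integrable_pattern hw A B) (hg.indicator hE)
  rw [← lintegral_indicator (h𝓕 E hE), ← lintegral_indicator (h𝓕 E hE)]
  have hind : ∀ (a : Ω → ENNReal), (E.indicator fun ω => a ω * g ω)
      = fun ω => a ω * E.indicator g ω := by
    intro a
    funext ω
    by_cases hω : ω ∈ E <;> simp [hω]
  rw [hind, hind, h]
  refine lintegral_congr_ae ?_
  filter_upwards [condExp_pattern hw hfb B A hAB] with ω hω
  by_cases hωE : ω ∈ E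
  · rw [hω (hav ω hωE)]
  · simp [hωE]

variable {d : ℕ}

lemma observed_cons (w : Fin m → Bool) (i : Fin m) (l : List (Fin m)) :
    observed w (i :: l) = if w i then [i] else i :: observed w l := by
  unfold observed
  cases h : w i <;> simp [List.findIdx_cons, h]

/-- The sum of the centred clicks times the features, over the checked items of the list `l`. -/
def noiseSum (w : Fin m → Bool) (p : Fin m → ℝ) (x : Fin m → Fin d → ℝ) (l : List (Fin m)) :
    Fin d → ℝ :=
  ((observed w l).map fun i => (click (w i) - p i) • x i).sum

/-- The Gram matrix of the checked items of the list `l`. -/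
def gramSum (w : Fin m → Bool) (x : Fin m → Fin d → ℝ) (l : List (Fin m)) :
    Matrix (Fin d) (Fin d) ℝ :=
  ((observed w l).map fun i => vecMulVec (x i) (x i)).sum

/-- The potential is a supermartingale within a round: by induction on the list, a click on the
first item ends the round, and otherwise the rest of the list is run on the event that this item
has not been clicked. The set `Q` holds the items that have been checked without a click. -/
lemma setLIntegral_potential_observed_le (h𝓕 : 𝓕 ≤ m0)
    (hw : ∀ i, MeasurableSet {ω | w ω i = true})
    (hfb : ∀ S : Finset (Fin m), ∀ᵐ ω ∂μ, S ⊆ av ω →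
      (μ[fun ω' => ∏ i ∈ S, click (w ω' i) | 𝓕]) ω = ∏ i ∈ S, p ω i)
    {x : Ω → Fin m → Fin d → ℝ} (hx : ∀ i, Measurable[𝓕] fun ω => x ω i)
    (hp : ∀ i, Measurable[𝓕] fun ω => p ω i)
    {E : Set Ω} (hE : MeasurableSet[𝓕] E) (l : List (Fin m)) (hl : l.Nodup) (Q : Finset (Fin m))
    (hQ : ∀ i ∈ l, i ∉ Q) (hQav : ∀ ω ∈ E, Q ⊆ av ω) (hav : ∀ ω ∈ E, ∀ i ∈ l, i ∈ av ω)
    {S : Ω → Fin d → ℝ} (hS : Measurable[𝓕] S)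
    {V : Ω → Matrix (Fin d) (Fin d) ℝ} (hV : Measurable[𝓕] V) (hVp : ∀ ω, (V ω).PosDef) :
    ∫⁻ ω in E, ENNReal.ofReal (pattern (w ω) ∅ Q) * ENNReal.ofReal
        (potential (S ω + noiseSum (w ω) (p ω) (x ω) l) (V ω + gramSum (w ω) (x ω) l)) ∂μ
      ≤ ∫⁻ ω in E, ENNReal.ofReal (pattern (w ω) ∅ Q) *
          ENNReal.ofReal (potential (S ω) (V ω)) ∂μ := by
  induction l generalizing Q S V with
  | nil => simp [noiseSum, gramSum, observed]
  | cons i l ih =>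
    have hiQ : i ∉ Q := hQ i (by simp)
    set V' : Ω → Matrix (Fin d) (Fin d) ℝ := fun ω => V ω + vecMulVec (x ω i) (x ω i) with hV'
    have hV'm : Measurable[𝓕] V' :=
      Measurable.add hV (@measurable_vecMulVec Ω 𝓕 _ _ _ (hx i) (hx i))
    have hV'p : ∀ ω, (V' ω).PosDef := fun ω =>
      (hVp ω).add_posSemidef (posSemidef_vecMulVec_self _)
    set S₀ : Ω → Fin d → ℝ := fun ω => S ω + (0 - p ω i) • x ω i with hS₀
    have hS₀m : Measurable[𝓕] S₀ :=
      @measurable_add_sub_smul Ω 𝓕 _ _ _ _ hS (hp i) (hx i) 0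
    set S₁ : Ω → Fin d → ℝ := fun ω => S ω + (1 - p ω i) • x ω i with hS₁
    have hS₁m : Measurable[𝓕] S₁ :=
      @measurable_add_sub_smul Ω 𝓕 _ _ _ _ hS (hp i) (hx i) 1
    have hφ₀ : Measurable[𝓕] fun ω => ENNReal.ofReal (potential (S₀ ω) (V' ω)) :=
      (@measurable_potential Ω 𝓕 _ _ _ hS₀m hV'm).ennreal_ofReal
    have hφ₁ : Measurable[𝓕] fun ω => ENNReal.ofReal (potential (S₁ ω) (V' ω)) :=
      (@measurable_potential Ω 𝓕 _ _ _ hS₁m hV'm).ennreal_ofReal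
    have hφ : Measurable[𝓕] fun ω => ENNReal.ofReal (potential (S ω) (V ω)) :=
      (@measurable_potential Ω 𝓕 _ _ _ hS hV).ennreal_ofReal
    have hsplit : ∀ ω, ENNReal.ofReal (pattern (w ω) ∅ Q) * ENNReal.ofReal
        (potential (S ω + noiseSum (w ω) (p ω) (x ω) (i :: l))
          (V ω + gramSum (w ω) (x ω) (i :: l)))
        = ENNReal.ofReal (pattern (w ω) {i} Q) * ENNReal.ofReal (potential (S₁ ω) (V' ω))
          + ENNReal.ofReal (pattern (w ω) ∅ (insert i Q)) * ENNReal.ofReal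
            (potential (S₀ ω + noiseSum (w ω) (p ω) (x ω) l)
              (V' ω + gramSum (w ω) (x ω) l)) := by
      intro ω
      cases h : w ω i <;>
        simp [noiseSum, gramSum, observed_cons, h, pattern, click, Finset.prod_insert hiQ, hS₀,
          hS₁, hV', add_assoc]
    simp_rw [hsplit]
    have hm : Measurable fun ω =>
        ENNReal.ofReal (pattern (w ω) {i} Q) * ENNReal.ofReal (potential (S₁ ω) (V' ω)) :=
      (measurable_pattern hw _ _).ennreal_ofReal.mul (hφ₁.mono h𝓕 le_rfl)
    rw [lintegral_add_left hm]
    have hrest := ih hl.of_cons (insert i Q) (fun j hj => by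
        rw [Finset.mem_insert, not_or]
        exact ⟨fun hji => (List.nodup_cons.1 hl).1 (hji ▸ hj), hQ j (by simp [hj])⟩)
      (fun ω hω => Finset.insert_subset (hav ω hω i (by simp)) (hQav ω hω))
      (fun ω hω j hj => hav ω hω j (by simp [hj])) hS₀m hV'm hV'p
    refine (add_le_add le_rfl hrest).trans ?_
    rw [setLIntegral_pattern h𝓕 hw hfb (by simpa using hiQ) hE (fun ω hω => by
        simpa [Finset.insert_subset_iff] using
          ⟨hav ω hω i (by simp), hQav ω hω⟩) hφ₁,
      setLIntegral_pattern h𝓕 hw hfb (by simp) hE (fun ω hω => by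
        simpa [Finset.insert_subset_iff] using
          ⟨hav ω hω i (by simp), hQav ω hω⟩) hφ₀,
      setLIntegral_pattern h𝓕 hw hfb (by simp) hE (fun ω hω => by
        simpa using hQav ω hω) hφ]
    have hpm : ∀ A B : Finset (Fin m),
        Measurable fun ω => (∏ j ∈ A, p ω j) * ∏ j ∈ B, (1 - p ω j) := fun A B =>
      (Finset.measurable_prod A fun j _ => (hp j).mono h𝓕 le_rfl).mul
        (Finset.measurable_prod B fun j _ => ((hp j).mono h𝓕 le_rfl).const_sub 1)
    have hm' : Measurable fun ω => ENNReal.ofReal ((∏ j ∈ {i}, p ω j) * ∏ j ∈ Q, (1 - p ω j)) *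
        ENNReal.ofReal (potential (S₁ ω) (V' ω)) :=
      (hpm _ _).ennreal_ofReal.mul (hφ₁.mono h𝓕 le_rfl)
    rw [← lintegral_add_left hm']
    refine lintegral_mono_ae ?_
    rw [ae_restrict_iff' (h𝓕 E hE)]
    filter_upwards [ae_all_iff.2 fun j => click_mean_mem_Icc hw hfb h𝓕 j] with ω hω hωE
    obtain ⟨h0, h1⟩ := hω i (hav ω hωE i (by simp))
    have hQ0 : 0 ≤ ∏ j ∈ Q, (1 - p ω j) := Finset.prod_nonneg fun j hj =>
      sub_nonneg.2 (hω j (hQav ω hωE hj)).2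
    have hpot : ∀ S V, 0 ≤ potential (d := d) S V := fun S V => by unfold potential; positivity
    simp only [Finset.prod_insert hiQ, Finset.prod_singleton, Finset.prod_empty, one_mul]
    rw [← ENNReal.ofReal_mul (by positivity),
      ← ENNReal.ofReal_mul (mul_nonneg (sub_nonneg.2 h1) hQ0), ← ENNReal.ofReal_mul hQ0,
      ← ENNReal.ofReal_add (mul_nonneg (by positivity) (hpot _ _))
        (mul_nonneg (mul_nonneg (sub_nonneg.2 h1) hQ0) (hpot _ _))]
    refine ENNReal.ofReal_le_ofReal ?_
    have := mul_le_mul_of_nonneg_left (potential_bernoulli_step (hVp ω) h0 h1 (S ω) (x ω i)) hQ0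
    simp only [hS₀, hS₁, hV']
    linarith

end Round

variable {U : Type*} [Fintype U] [DecidableEq U] {m d : ℕ}

/-! ### Measurability of the algorithm -/

section Structures
variable {Ω : Type*} [MeasurableSpace Ω]

/-- The part of a random round input that is revealed before the feedback is measurable. Discrete
fields are measurable in the sense that their level sets are. -/
structure ContextMeasurable (inp : Ω → RoundInput U m d) : Prop where
  user : ∀ v, MeasurableSet {ω | (inp ω).user = v}
  avail : ∀ S, MeasurableSet {ω | (inp ω).avail = S}
  feas : ∀ A, MeasurableSet {ω | (inp ω).feas = A}
  x : ∀ i, Measurable fun ω => (inp ω).x i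

/-- A random state of the algorithm is measurable. -/
structure StateMeasurable (st : Ω → AlgState U d) : Prop where
  gram : ∀ v, Measurable fun ω => (st ω).gram v
  est : ∀ v, Measurable fun ω => (st ω).est v
  locGram : ∀ v, Measurable fun ω => (st ω).locGram v
  locVec : ∀ v, Measurable fun ω => (st ω).locVec v
  locCount : ∀ v, Measurable fun ω => (st ω).locCount v
  serGram : ∀ v, Measurable fun ω => (st ω).serGram v
  serVec : ∀ v, Measurable fun ω => (st ω).serVec v
  serCount : ∀ v, Measurable fun ω => (st ω).serCount v
  graph : ∀ a b, MeasurableSet {ω | (st ω).graph.Adj a b}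

end Structures

section StateMeasurability
variable {Ω : Type*} {_ : MeasurableSpace Ω}

lemma measurable_comp_countable {ι β : Type*} [Countable ι] [MeasurableSpace β] {f : ι → Ω → β}
    {g : Ω → ι} (hg : ∀ i, MeasurableSet {ω | g ω = i}) (hf : ∀ i, Measurable (f i)) :
    Measurable fun ω => f (g ω) ω := by
  intro s hs
  have : (fun ω => f (g ω) ω) ⁻¹' s = ⋃ i, {ω | g ω = i} ∩ f i ⁻¹' s := by
    ext ω
    simp
  rw [this]
  exact MeasurableSet.iUnion fun i => (hg i).inter (hf i hs)

lemma measurableSet_comp_countable {ι : Type*} [Countable ι] {f : ι → Ω → Prop}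
    {g : Ω → ι} (hg : ∀ i, MeasurableSet {ω | g ω = i}) (hf : ∀ i, MeasurableSet {ω | f i ω}) :
    MeasurableSet {ω | f (g ω) ω} := by
  have : {ω | f (g ω) ω} = ⋃ i, {ω | g ω = i} ∩ {ω | f i ω} := by
    ext ω
    simp
  rw [this]
  exact MeasurableSet.iUnion fun i => (hg i).inter (hf i)

lemma measurable_list_sum_map {ι β : Type*} [AddMonoid β] [MeasurableSpace β] [MeasurableAdd₂ β]
    {f : ι → Ω → β} (hf : ∀ i, Measurable (f i)) (l : List ι) :
    Measurable fun ω => (l.map fun i => f i ω).sum := by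
  induction l with
  | nil => simp
  | cons i l ih =>
    simp only [List.map_cons, List.sum_cons]
    exact (hf i).add ih

lemma measurable_update_apply {β : Type*} [MeasurableSpace β] {a : Ω → U → β} {g : Ω → U}
    {b : Ω → β} (hg : ∀ v, MeasurableSet {ω | g ω = v}) (ha : ∀ v, Measurable fun ω => a ω v)
    (hb : Measurable b) (v : U) : Measurable fun ω => Function.update (a ω) (g ω) (b ω) v := by
  refine measurable_comp_countable (f := fun u ω => Function.update (a ω) u (b ω) v) hg fun u => ?_
  by_cases h : v = u
  · simpa [h] using hb
  · simpa [Function.update_of_ne h] using ha v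

variable {inp : Ω → RoundInput U m d} {st : Ω → AlgState U d} {P : Params m d}

lemma StateMeasurable.graph_eq (hst : StateMeasurable st) (G : SimpleGraph U) :
    MeasurableSet {ω | (st ω).graph = G} := by
  have : {ω | (st ω).graph = G} = ⋂ a, ⋂ b, {ω | (st ω).graph.Adj a b ↔ G.Adj a b} := by
    ext ω
    simp [SimpleGraph.ext_iff, funext_iff]
  rw [this]
  refine MeasurableSet.iInter fun a => MeasurableSet.iInter fun b => ?_
  by_cases h : G.Adj a b
  · simpa only [h, iff_true] using hst.graph a b
  · simp only [h, iff_false]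
    exact (hst.graph a b).compl

lemma measurable_ucb (hinp : ContextMeasurable inp) (hst : StateMeasurable st) :
    Measurable fun ω => ucb P (inp ω) (st ω) := by
  rw [measurable_pi_iff]
  intro i
  unfold ucb
  refine measurable_comp_countable (g := fun ω => (inp ω).avail) (f := fun S ω => if i ∈ S then
    min ((st ω).est (inp ω).user ⬝ᵥ (inp ω).x i
      + P.β * matNorm ((st ω).gram (inp ω).user)⁻¹ ((inp ω).x i)) 1 else 0)
    hinp.avail fun S => ?_
  by_cases hi : i ∈ S
  · simp only [hi, if_true]
    refine Measurable.min ?_ measurable_const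
    refine measurable_comp_countable (g := fun ω => (inp ω).user) (f := fun u ω =>
      (st ω).est u ⬝ᵥ (inp ω).x i + P.β * matNorm ((st ω).gram u)⁻¹ ((inp ω).x i))
      hinp.user fun u => ?_
    unfold matNorm
    exact (measurable_dotProduct (hst.est u) (hinp.x i)).add
      ((measurable_dotProduct (hinp.x i) (measurable_mulVec
        (measurable_matrix_inv.comp (hst.gram u)) (hinp.x i))).sqrt.const_mul _)
  · simp [hi]

lemma measurableSet_action (horacle : ∀ A a, MeasurableSet {W : Fin m → ℝ | P.oracle A W = a})
    (hinp : ContextMeasurable inp) (hst : StateMeasurable st) (a : List (Fin m)) :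
    MeasurableSet {ω | action P (inp ω) (st ω) = a} := by
  unfold action
  exact measurableSet_comp_countable (g := fun ω => (inp ω).feas)
    (f := fun A ω => P.oracle A (ucb P (inp ω) (st ω)) = a) hinp.feas
    fun A => measurable_ucb hinp hst (horacle A a)

lemma measurableSet_clicks (hw : ∀ i, MeasurableSet {ω | (inp ω).w i = true})
    (b : Fin m → Bool) : MeasurableSet {ω | (inp ω).w = b} := by
  have : {ω | (inp ω).w = b} = ⋂ i, {ω | (inp ω).w i = b i} := by
    ext ω
    simp [funext_iff]
  rw [this]
  refine MeasurableSet.iInter fun i => ?_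
  cases b i
  · simpa [Set.compl_def] using (hw i).compl
  · exact hw i

lemma measurableSet_observed (hw : ∀ i, MeasurableSet {ω | (inp ω).w i = true})
    {a : Ω → List (Fin m)} (ha : ∀ l, MeasurableSet {ω | a ω = l}) (l : List (Fin m)) :
    MeasurableSet {ω | observed (inp ω).w (a ω) = l} :=
  measurableSet_comp_countable (g := fun ω => (inp ω).w)
    (f := fun b ω => observed b (a ω) = l) (measurableSet_clicks hw) fun b =>
    measurableSet_comp_countable (g := a) (f := fun a' _ => observed b a' = l) ha
      fun _ => MeasurableSet.const _

lemma measurableSet_obs (horacle : ∀ A a, MeasurableSet {W : Fin m → ℝ | P.oracle A W = a})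
    (hinp : ContextMeasurable inp) (hw : ∀ i, MeasurableSet {ω | (inp ω).w i = true})
    (hst : StateMeasurable st) (l : List (Fin m)) :
    MeasurableSet {ω | obs P (inp ω) (st ω) = l} :=
  measurableSet_observed hw (measurableSet_action horacle hinp hst) l

lemma measurable_newLocGram (horacle : ∀ A a, MeasurableSet {W : Fin m → ℝ | P.oracle A W = a})
    (hinp : ContextMeasurable inp) (hw : ∀ i, MeasurableSet {ω | (inp ω).w i = true})
    (hst : StateMeasurable st) : Measurable fun ω => newLocGram P (inp ω) (st ω) := by
  unfold newLocGram
  refine Measurable.add (measurable_comp_countable (g := fun ω => (inp ω).user)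
    (f := fun u ω => (st ω).locGram u) hinp.user hst.locGram) ?_
  exact measurable_comp_countable (g := fun ω => obs P (inp ω) (st ω))
    (f := fun l ω => (l.map fun i => vecMulVec ((inp ω).x i) ((inp ω).x i)).sum)
    (measurableSet_obs horacle hinp hw hst)
    fun l => measurable_list_sum_map
      (f := fun i ω => vecMulVec ((inp ω).x i) ((inp ω).x i))
      (fun i => measurable_vecMulVec (hinp.x i) (hinp.x i)) l

lemma measurable_newLocVec (horacle : ∀ A a, MeasurableSet {W : Fin m → ℝ | P.oracle A W = a})
    (hinp : ContextMeasurable inp) (hw : ∀ i, MeasurableSet {ω | (inp ω).w i = true})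
    (hst : StateMeasurable st) : Measurable fun ω => newLocVec P (inp ω) (st ω) := by
  unfold newLocVec
  refine Measurable.add (measurable_comp_countable (g := fun ω => (inp ω).user)
    (f := fun u ω => (st ω).locVec u) hinp.user hst.locVec) ?_
  exact measurable_comp_countable (g := fun ω => obs P (inp ω) (st ω))
    (f := fun l ω => (l.map fun i =>
      (if (inp ω).w i then (1 : ℝ) else 0) • (inp ω).x i).sum)
    (measurableSet_obs horacle hinp hw hst)
    fun l => measurable_list_sum_map
      (f := fun i ω => (if (inp ω).w i then (1 : ℝ) else 0) • (inp ω).x i)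
      (fun i => (measurable_click hw i).smul (hinp.x i)) l

lemma measurable_newLocCount (horacle : ∀ A a, MeasurableSet {W : Fin m → ℝ | P.oracle A W = a})
    (hinp : ContextMeasurable inp) (hw : ∀ i, MeasurableSet {ω | (inp ω).w i = true})
    (hst : StateMeasurable st) : Measurable fun ω => newLocCount P (inp ω) (st ω) := by
  unfold newLocCount
  refine Measurable.add (measurable_comp_countable (g := fun ω => (inp ω).user)
    (f := fun u ω => (st ω).locCount u) hinp.user hst.locCount) ?_
  exact measurable_comp_countable (g := fun ω => obs P (inp ω) (st ω))
    (f := fun l _ => l.length)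
    (measurableSet_obs horacle hinp hw hst) fun l => measurable_const

lemma measurableSet_communicates
    (horacle : ∀ A a, MeasurableSet {W : Fin m → ℝ | P.oracle A W = a})
    (hinp : ContextMeasurable inp) (hw : ∀ i, MeasurableSet {ω | (inp ω).w i = true})
    (hcoin : Measurable fun ω => (inp ω).coin) (hst : StateMeasurable st) (t : ℕ) :
    MeasurableSet {ω | Communicates P t (inp ω) (st ω)} := by
  have hg : Measurable fun ω => (st ω).gram (inp ω).user :=
    measurable_comp_countable (g := fun ω => (inp ω).user)
      (f := fun u ω => (st ω).gram u) hinp.user hst.gram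
  unfold Communicates
  exact (measurableSet_lt ((measurable_matrix_det.comp hg).const_mul _)
    (measurable_matrix_det.comp (hg.add (measurable_newLocGram horacle hinp hw hst)))).union
    (measurableSet_lt hcoin measurable_const)

lemma measurable_l2norm : Measurable (l2norm : (Fin d → ℝ) → ℝ) := by
  unfold l2norm
  exact (PiLp.continuous_toLp 2 _).norm.measurable

lemma measurable_testWidth : Measurable testWidth := measurable_from_nat

lemma StateMeasurable.localStep
    (horacle : ∀ A a, MeasurableSet {W : Fin m → ℝ | P.oracle A W = a})
    (hinp : ContextMeasurable inp) (hw : ∀ i, MeasurableSet {ω | (inp ω).w i = true})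
    (hst : StateMeasurable st) : StateMeasurable fun ω => localStep P (inp ω) (st ω) where
  gram := hst.gram
  est := hst.est
  locGram := measurable_update_apply hinp.user hst.locGram
    (measurable_newLocGram horacle hinp hw hst)
  locVec := measurable_update_apply hinp.user hst.locVec
    (measurable_newLocVec horacle hinp hw hst)
  locCount := measurable_update_apply hinp.user hst.locCount
    (measurable_newLocCount horacle hinp hw hst)
  serGram := hst.serGram
  serVec := hst.serVec
  serCount := hst.serCount
  graph := hst.graph

lemma StateMeasurable.commStep
    (horacle : ∀ A a, MeasurableSet {W : Fin m → ℝ | P.oracle A W = a})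
    (hinp : ContextMeasurable inp) (hw : ∀ i, MeasurableSet {ω | (inp ω).w i = true})
    (hst : StateMeasurable st) : StateMeasurable fun ω => commStep P (inp ω) (st ω) := by
  have hat : ∀ {β : Type} [MeasurableSpace β] {f : U → Ω → β}, (∀ u, Measurable (f u)) →
      Measurable fun ω => f (inp ω).user ω := fun hf =>
    measurable_comp_countable (g := fun ω => (inp ω).user) hinp.user hf
  have hserGram := measurable_update_apply hinp.user hst.serGram
    ((hat hst.serGram).add (measurable_newLocGram horacle hinp hw hst))
  have hserVec := measurable_update_apply hinp.user hst.serVec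
    ((hat hst.serVec).add (measurable_newLocVec horacle hinp hw hst))
  have hserCount := measurable_update_apply hinp.user hst.serCount
    ((hat hst.serCount).add (measurable_newLocCount horacle hinp hw hst))
  have hcomp : ∀ {β : Type} [AddCommMonoid β] [MeasurableSpace β] [MeasurableAdd₂ β]
      {f : U → Ω → β}, (∀ u, Measurable (f u)) →
      Measurable fun ω => ∑ v ∈ component (st ω).graph (inp ω).user, f v ω := by
    intro β _ _ _ f hf
    refine hat (f := fun u ω => ∑ v ∈ component (st ω).graph u, f v ω) fun u => ?_
    exact measurable_comp_countable (g := fun ω => (st ω).graph)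
      (f := fun G ω => ∑ v ∈ component G u, f v ω) hst.graph_eq
      fun G => Finset.measurable_sum _ fun v _ => hf v
  have hcluGram := (hcomp hserGram).const_add (P.lam • (1 : Matrix (Fin d) (Fin d) ℝ))
  have hcluVec := hcomp hserVec
  refine ⟨measurable_update_apply hinp.user hst.gram hcluGram,
    measurable_update_apply hinp.user hst.est
      (measurable_mulVec (measurable_matrix_inv.comp hcluGram) hcluVec),
    measurable_update_apply hinp.user hst.locGram measurable_const,
    measurable_update_apply hinp.user hst.locVec measurable_const,
    measurable_update_apply hinp.user hst.locCount measurable_const,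
    hserGram, hserVec, hserCount, fun a b => ?_⟩
  have hserEst := fun v => measurable_mulVec (measurable_matrix_inv.comp
    ((hserGram v).const_add (P.lam • (1 : Matrix (Fin d) (Fin d) ℝ)))) (hserVec v)
  simp only [FedC3B.commStep, SimpleGraph.deleteEdges_adj, Set.mem_ofPred_eq]
  refine (hst.graph a b).inter (MeasurableSet.compl ?_)
  have hex : ∀ v, MeasurableSet {ω | v ≠ (inp ω).user ∧ s(a, b) = s((inp ω).user, v)} := fun v =>
    measurableSet_comp_countable (g := fun ω => (inp ω).user)
      (f := fun u _ => v ≠ u ∧ s(a, b) = s(u, v)) hinp.user fun u => MeasurableSet.const _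
  refine (measurableSet_setOfPred.2 (Measurable.exists fun v => measurableSet_setOfPred.1 ?_))
  simp only [← and_assoc]
  have hlt := measurableSet_lt
    (((measurable_testWidth.comp (hat hserCount)).add
      (measurable_testWidth.comp (hserCount v))).const_mul P.αd)
    (measurable_l2norm.comp ((hat hserEst).sub (hserEst v)))
  exact (hex v).inter hlt

lemma StateMeasurable.step
    (horacle : ∀ A a, MeasurableSet {W : Fin m → ℝ | P.oracle A W = a})
    (hinp : ContextMeasurable inp) (hw : ∀ i, MeasurableSet {ω | (inp ω).w i = true})
    (hcoin : Measurable fun ω => (inp ω).coin) (hst : StateMeasurable st) (t : ℕ) :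
    StateMeasurable fun ω => step P t (inp ω) (st ω) := by
  classical
  have hc := measurableSet_communicates horacle hinp hw hcoin hst t
  have h1 := hst.commStep horacle hinp hw
  have h2 := hst.localStep horacle hinp hw
  have hm : ∀ {β : Type} [MeasurableSpace β] (f : AlgState U d → β),
      Measurable (fun ω => f (FedC3B.commStep P (inp ω) (st ω))) →
      Measurable (fun ω => f (FedC3B.localStep P (inp ω) (st ω))) →
      Measurable fun ω => f (FedC3B.step P t (inp ω) (st ω)) := by
    intro β _ f hf1 hf2
    unfold FedC3B.step
    simp only [apply_ite f]
    exact Measurable.ite hc hf1 hf2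
  exact ⟨fun v => hm (fun s => s.gram v) (h1.gram v) (h2.gram v),
    fun v => hm (fun s => s.est v) (h1.est v) (h2.est v),
    fun v => hm (fun s => s.locGram v) (h1.locGram v) (h2.locGram v),
    fun v => hm (fun s => s.locVec v) (h1.locVec v) (h2.locVec v),
    fun v => hm (fun s => s.locCount v) (h1.locCount v) (h2.locCount v),
    fun v => hm (fun s => s.serGram v) (h1.serGram v) (h2.serGram v),
    fun v => hm (fun s => s.serVec v) (h1.serVec v) (h2.serVec v),
    fun v => hm (fun s => s.serCount v) (h1.serCount v) (h2.serCount v),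
    fun a b => measurableSet_setOfPred.2 (hm (fun s => s.graph.Adj a b)
      (measurableSet_setOfPred.1 (h1.graph a b)) (measurableSet_setOfPred.1 (h2.graph a b)))⟩

lemma stateMeasurable_const (s : AlgState U d) : StateMeasurable fun _ : Ω => s :=
  ⟨fun _ => measurable_const, fun _ => measurable_const, fun _ => measurable_const,
    fun _ => measurable_const, fun _ => measurable_const, fun _ => measurable_const,
    fun _ => measurable_const, fun _ => measurable_const, fun _ _ => MeasurableSet.const _⟩

end StateMeasurability

/-! ### The history of a cluster -/

section History

/-- The action of round `τ` if it is played by a user of `C`, and the empty list otherwise. -/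
def playedBy (P : Params m d) (inp : ℕ → RoundInput U m d) (C : Finset U) (τ : ℕ) :
    List (Fin m) :=
  if (inp τ).user ∈ C then action P (inp τ) (stateAt P inp τ) else []

/-- The click probability of an item. -/
def clickMean {J : ℕ} (cl : U → Fin J) (θ : Fin J → Fin d → ℝ) (inp : RoundInput U m d)
    (i : Fin m) : ℝ :=
  θ (cl inp.user) ⬝ᵥ inp.x i

/-- The sum of the centred clicks times the features, over the items checked by the users of `C` in
the rounds `s + 1, …, r`. -/
def noiseOf {J : ℕ} (cl : U → Fin J) (θ : Fin J → Fin d → ℝ) (P : Params m d)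
    (inp : ℕ → RoundInput U m d) (C : Finset U) (s r : ℕ) : Fin d → ℝ :=
  ∑ τ ∈ Finset.Ioc s r,
    noiseSum (inp τ).w (clickMean cl θ (inp τ)) (inp τ).x (playedBy P inp C τ)

/-- The Gram matrix of the items checked by the users of `C` in the rounds `s + 1, …, r`. -/
def gramOf (P : Params m d) (inp : ℕ → RoundInput U m d) (C : Finset U) (s r : ℕ) :
    Matrix (Fin d) (Fin d) ℝ :=
  ∑ τ ∈ Finset.Ioc s r, gramSum (inp τ).w (inp τ).x (playedBy P inp C τ)

lemma posSemidef_gramSum (w : Fin m → Bool) (x : Fin m → Fin d → ℝ) (l : List (Fin m)) :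
    (gramSum w x l).PosSemidef := by
  unfold gramSum
  induction observed w l with
  | nil => simpa using PosSemidef.zero
  | cons i l ih => simpa using (posSemidef_vecMulVec_self (x i)).add ih

lemma posSemidef_gramOf (P : Params m d) (inp : ℕ → RoundInput U m d) (C : Finset U) (s r : ℕ) :
    (gramOf P inp C s r).PosSemidef :=
  posSemidef_sum _ fun _ _ => posSemidef_gramSum _ _ _

lemma posDef_smul_one_add {ρ : ℝ} (hρ : 0 < ρ) {G : Matrix (Fin d) (Fin d) ℝ}
    (hG : G.PosSemidef) : (ρ • (1 : Matrix (Fin d) (Fin d) ℝ) + G).PosDef :=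
  (PosDef.one.smul hρ).add_posSemidef hG

variable {Ω : Type*} [mΩ : MeasurableSpace Ω] {μ : Measure Ω} {J K T : ℕ} {cl : U → Fin J}
  {θ : Fin J → Fin d → ℝ} {inp : ℕ → Ω → RoundInput U m d} {ℱ : Filtration ℕ mΩ}
  {P : Params m d}

lemma IsEnvironment.measurableSet_user (henv : IsEnvironment μ K T cl θ inp ℱ) {t t' : ℕ}
    (ht : t ∈ Finset.Icc 1 T) (htt' : t ≤ t') (v : U) :
    MeasurableSet[ℱ t'] {ω | (inp t ω).user = v} :=
  ℱ.mono htt' _ (henv.user_meas t ht v)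

lemma IsEnvironment.measurable_x (henv : IsEnvironment μ K T cl θ inp ℱ) {t t' : ℕ}
    (ht : t ∈ Finset.Icc 1 T) (htt' : t ≤ t') (i : Fin m) :
    Measurable[ℱ t'] fun ω => (inp t ω).x i :=
  @measurable_pi_lambda _ _ _ (ℱ t') _ _ fun k =>
    (henv.x_meas t ht i k).mono (ℱ.mono htt') le_rfl

lemma IsEnvironment.contextMeasurable (henv : IsEnvironment μ K T cl θ inp ℱ) {t t' : ℕ}
    (ht : t ∈ Finset.Icc 1 T) (htt' : t ≤ t') : @ContextMeasurable U m d Ω (ℱ t') (inp t) :=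
  @ContextMeasurable.mk _ _ _ _ (ℱ t') _
    (henv.measurableSet_user ht htt')
    (fun S => ℱ.mono htt' _ (henv.avail_meas t ht S))
    (fun A => ℱ.mono htt' _ (henv.feas_meas t ht A))
    (henv.measurable_x ht htt')

lemma IsEnvironment.stateMeasurable (henv : IsEnvironment μ K T cl θ inp ℱ)
    (horacle : ∀ A a, MeasurableSet {W : Fin m → ℝ | P.oracle A W = a}) {t t' : ℕ}
    (ht : t ≤ T + 1) (htt' : t ≤ t') :
    @StateMeasurable U d Ω (ℱ t') fun ω => stateAt P (fun s => inp s ω) t := by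
  induction t using Nat.strong_induction_on generalizing t' with
  | _ t ih =>
    match t with
    | 0 => exact @stateMeasurable_const _ _ _ _ _ (ℱ t') _
    | 1 => exact @stateMeasurable_const _ _ _ _ _ (ℱ t') _
    | t + 2 =>
      have hmem : t + 1 ∈ Finset.Icc 1 T := by simp; omega
      exact @StateMeasurable.step _ _ _ _ _ _ (ℱ t') _ _ _ horacle
        (henv.contextMeasurable hmem (by omega))
        (fun i => ℱ.mono htt' _ (henv.w_meas _ hmem i))
        ((henv.coin_meas _ hmem).mono (ℱ.mono htt') le_rfl)
        (ih (t + 1) (by omega) (by omega) (by omega)) (t + 1)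

lemma IsEnvironment.measurableSet_playedBy (henv : IsEnvironment μ K T cl θ inp ℱ)
    (horacle : ∀ A a, MeasurableSet {W : Fin m → ℝ | P.oracle A W = a}) {t t' : ℕ}
    (ht : t ∈ Finset.Icc 1 T) (htt' : t ≤ t') (C : Finset U) (l : List (Fin m)) :
    MeasurableSet[ℱ t'] {ω | playedBy P (fun s => inp s ω) C t = l} := by
  have hc := henv.contextMeasurable ht htt'
  have ha := @measurableSet_action _ _ _ _ _ _ (ℱ t') _ _ _ horacle hc
    (henv.stateMeasurable horacle (by simp at ht; omega) htt') l
  refine @measurableSet_comp_countable _ (ℱ t') _ _ (fun u ω =>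
    (if u ∈ C then action P (inp t ω) (stateAt P (fun s => inp s ω) t) else []) = l)
    (fun ω => (inp t ω).user) (henv.measurableSet_user ht htt') fun u => ?_
  by_cases hu : u ∈ C
  · simpa [hu] using ha
  · simp [hu]

lemma IsEnvironment.measurable_clickMean (henv : IsEnvironment μ K T cl θ inp ℱ) {t t' : ℕ}
    (ht : t ∈ Finset.Icc 1 T) (htt' : t ≤ t') (i : Fin m) :
    Measurable[ℱ t'] fun ω => clickMean cl θ (inp t ω) i :=
  @measurable_comp_countable _ (ℱ t') _ _ _ _
    (fun u ω => θ (cl u) ⬝ᵥ (inp t ω).x i) (fun ω => (inp t ω).user)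
    (henv.measurableSet_user ht htt')
    fun _ => @measurable_dotProduct _ (ℱ t') _ _ _ (@measurable_const _ _ _ (ℱ t') _)
      (henv.measurable_x ht htt' i)

lemma IsEnvironment.measurable_noiseOf (henv : IsEnvironment μ K T cl θ inp ℱ)
    (horacle : ∀ A a, MeasurableSet {W : Fin m → ℝ | P.oracle A W = a}) {r t : ℕ}
    (hr : r ≤ T) (hrt : r < t) (C : Finset U) (s : ℕ) :
    Measurable[ℱ t] fun ω => noiseOf cl θ P (fun s => inp s ω) C s r := by
  unfold noiseOf
  refine @Finset.measurable_sum _ _ _ _ _ _ (ℱ t) _ _ fun τ hτ => ?_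
  rw [Finset.mem_Ioc] at hτ
  have hmem : τ ∈ Finset.Icc 1 T := by simp; omega
  have hw : ∀ i, MeasurableSet[ℱ t] {ω | (inp τ ω).w i = true} := fun i =>
    ℱ.mono (by omega) _ (henv.w_meas τ hmem i)
  exact @measurable_comp_countable _ (ℱ t) _ _ _ _
    (fun l ω => (l.map fun i =>
      (click ((inp τ ω).w i) - clickMean cl θ (inp τ ω) i) • (inp τ ω).x i).sum) _
    (@measurableSet_observed _ _ _ _ _ _ (ℱ t) _ hw _
      (henv.measurableSet_playedBy horacle hmem (by omega) C))
    fun l => @measurable_list_sum_map _ (ℱ t) _ _ _ _ _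
      (fun i ω => (click ((inp τ ω).w i) - clickMean cl θ (inp τ ω) i) • (inp τ ω).x i)
      (fun i => ((@measurable_click _ (ℱ t) _ _ hw i).sub
        (henv.measurable_clickMean hmem (by omega) i)).smul
        (henv.measurable_x hmem (by omega) i)) l

lemma IsEnvironment.measurable_gramOf (henv : IsEnvironment μ K T cl θ inp ℱ)
    (horacle : ∀ A a, MeasurableSet {W : Fin m → ℝ | P.oracle A W = a}) {r t : ℕ}
    (hr : r ≤ T) (hrt : r < t) (C : Finset U) (s : ℕ) :
    Measurable[ℱ t] fun ω => gramOf P (fun s => inp s ω) C s r := by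
  unfold gramOf
  refine @Finset.measurable_sum _ _ _ _ _ _ (ℱ t) _ _ fun τ hτ => ?_
  rw [Finset.mem_Ioc] at hτ
  have hmem : τ ∈ Finset.Icc 1 T := by simp; omega
  have hw : ∀ i, MeasurableSet[ℱ t] {ω | (inp τ ω).w i = true} := fun i =>
    ℱ.mono (by omega) _ (henv.w_meas τ hmem i)
  exact @measurable_comp_countable _ (ℱ t) _ _ _ _
    (fun l ω => (l.map fun i => vecMulVec ((inp τ ω).x i) ((inp τ ω).x i)).sum) _
    (@measurableSet_observed _ _ _ _ _ _ (ℱ t) _ hw _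
      (henv.measurableSet_playedBy horacle hmem (by omega) C))
    fun l => @measurable_list_sum_map _ (ℱ t) _ _ _ _ _
      (fun i ω => vecMulVec ((inp τ ω).x i) ((inp τ ω).x i))
      (fun i => @measurable_vecMulVec _ (ℱ t) _ _ _
        (henv.measurable_x hmem (by omega) i)
        (henv.measurable_x hmem (by omega) i)) l

lemma IsEnvironment.playedBy_spec (henv : IsEnvironment μ K T cl θ inp ℱ)
    (horacle : ∀ A : Finset (List (Fin m)), A.Nonempty → ∀ W, P.oracle A W ∈ A) {t : ℕ}
    (ht : t ∈ Finset.Icc 1 T) (C : Finset U) (ω : Ω) :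
    (playedBy P (fun s => inp s ω) C t).Nodup ∧
      (playedBy P (fun s => inp s ω) C t).length ≤ K ∧
      ∀ i ∈ playedBy P (fun s => inp s ω) C t, i ∈ (inp t ω).avail := by
  unfold playedBy
  split_ifs with h
  · exact (henv.feas_spec t ht ω _ (horacle _ (henv.feas_nonempty t ht ω) _)).2
  · simp

/-- The potential of the data of the users of `C` is a supermartingale, so its mean is at most its
initial value. -/
lemma IsEnvironment.lintegral_potential_le [IsProbabilityMeasure μ]
    (henv : IsEnvironment μ K T cl θ inp ℱ)
    (horacle : ∀ A : Finset (List (Fin m)), A.Nonempty → ∀ W, P.oracle A W ∈ A)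
    (horacle_meas : ∀ A a, MeasurableSet {W : Fin m → ℝ | P.oracle A W = a})
    {ρ : ℝ} (hρ : 0 < ρ) (C : Finset U) {s r : ℕ} (hsr : s ≤ r) (hr : r ≤ T) :
    ∫⁻ ω, ENNReal.ofReal (potential (noiseOf cl θ P (fun τ => inp τ ω) C s r)
      (ρ • 1 + gramOf P (fun τ => inp τ ω) C s r)) ∂μ ≤ ENNReal.ofReal (1 / √(ρ ^ d)) := by
  induction r, hsr using Nat.le_induction with
  | base => simp [noiseOf, gramOf, potential]
  | succ r hsr ih =>
    refine le_trans ?_ (ih (by omega))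
    have hmem : r + 1 ∈ Finset.Icc 1 T := by simp; omega
    have h𝓕 : ℱ (r + 1) ≤ mΩ := ℱ.le _
    -- the list played by `C` is known before the feedback: fix its value `l`
    set E : List (Fin m) → Set Ω := fun l => {ω | playedBy P (fun τ => inp τ ω) C (r + 1) = l}
      with hE
    have hEm : ∀ l, MeasurableSet[ℱ (r + 1)] (E l) :=
      henv.measurableSet_playedBy horacle_meas hmem le_rfl C
    have hEu : ⋃ l, E l = Set.univ := by ext ω; simp [hE]
    have hEd : Pairwise (Function.onFun Disjoint E) := fun l l' hll' =>
      Set.disjoint_left.2 fun ω h h' => hll' (h.symm.trans h')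
    have hdec : ∀ f : Ω → ENNReal, ∫⁻ ω, f ω ∂μ = ∑' l, ∫⁻ ω in E l, f ω ∂μ := fun f => by
      rw [← lintegral_iUnion (fun l => h𝓕 _ (hEm l)) hEd, hEu, Measure.restrict_univ]
    rw [hdec, hdec]
    refine ENNReal.tsum_le_tsum fun l => ?_
    rcases (E l).eq_empty_or_nonempty with hem | ⟨ω₀, hω₀⟩
    · simp [hem]
    have hspec := henv.playedBy_spec horacle hmem C
    have hl : l.Nodup := by
      have := (hspec ω₀).1
      rwa [show playedBy P (fun τ => inp τ ω₀) C (r + 1) = l from hω₀] at this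
    have hav : ∀ ω ∈ E l, ∀ i ∈ l, i ∈ (inp (r + 1) ω).avail := fun ω hω i hi =>
      (hspec ω).2.2 i (by rwa [show playedBy P (fun τ => inp τ ω) C (r + 1) = l from hω])
    have hround := setLIntegral_potential_observed_le (μ := μ) h𝓕
      (w := fun ω => (inp (r + 1) ω).w) (p := fun ω => clickMean cl θ (inp (r + 1) ω))
      (av := fun ω => (inp (r + 1) ω).avail)
      (fun i => ℱ.le _ _ (henv.w_meas _ hmem i)) (henv.feedback _ hmem)
      (henv.measurable_x hmem le_rfl)
      (henv.measurable_clickMean hmem le_rfl) (hEm l) l hl ∅ (by simp) (by simp) hav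
      (henv.measurable_noiseOf horacle_meas (by omega) (Nat.lt_succ_self r) C s)
      (Measurable.const_add (henv.measurable_gramOf horacle_meas (by omega)
        (Nat.lt_succ_self r) C s) (ρ • (1 : Matrix (Fin d) (Fin d) ℝ)))
      (fun ω => posDef_smul_one_add hρ (posSemidef_gramOf P _ C s r))
    simp only [pattern, Finset.prod_empty, one_mul, ENNReal.ofReal_one] at hround
    refine le_trans (le_of_eq ?_) hround
    refine setLIntegral_congr_fun (h𝓕 _ (hEm l)) fun ω hω => ?_
    have hω' : playedBy P (fun τ => inp τ ω) C (r + 1) = l := hω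
    simp only [noiseOf, gramOf, Finset.sum_Ioc_succ_top hsr, hω', add_assoc]

end History

section Deterministic
variable {P : Params m d} {inp : ℕ → RoundInput U m d}

/-! ### Data collected over several rounds -/

section Data
variable {J : ℕ} {cl : U → Fin J} {θ : Fin J → Fin d → ℝ}

lemma noiseOf_self (C : Finset U) (s : ℕ) : noiseOf cl θ P inp C s s = 0 := by simp [noiseOf]

lemma gramOf_self (C : Finset U) (s : ℕ) : gramOf P inp C s s = 0 := by simp [gramOf]

lemma noiseOf_add (C : Finset U) {a b c : ℕ} (hab : a ≤ b) (hbc : b ≤ c) :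
    noiseOf cl θ P inp C a b + noiseOf cl θ P inp C b c = noiseOf cl θ P inp C a c := by
  unfold noiseOf
  rw [← Finset.Ioc_union_Ioc_eq_Ioc hab hbc, Finset.sum_union (by
    rw [Finset.disjoint_left]; intro x; simp only [Finset.mem_Ioc]; omega)]

lemma gramOf_add (C : Finset U) {a b c : ℕ} (hab : a ≤ b) (hbc : b ≤ c) :
    gramOf P inp C a b + gramOf P inp C b c = gramOf P inp C a c := by
  unfold gramOf
  rw [← Finset.Ioc_union_Ioc_eq_Ioc hab hbc, Finset.sum_union (by
    rw [Finset.disjoint_left]; intro x; simp only [Finset.mem_Ioc]; omega)]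

lemma noiseSum_nil (w : Fin m → Bool) (p : Fin m → ℝ) (x : Fin m → Fin d → ℝ) :
    noiseSum w p x [] = 0 := by simp [noiseSum, observed]

lemma gramSum_nil (w : Fin m → Bool) (x : Fin m → Fin d → ℝ) : gramSum w x [] = 0 := by
  simp [gramSum, observed]

lemma sum_playedBy {β : Type*} [AddCommMonoid β] (F : List (Fin m) → β) (hF : F [] = 0)
    (C : Finset U) (τ : ℕ) :
    ∑ v ∈ C, F (playedBy P inp {v} τ) = F (playedBy P inp C τ) := by
  unfold playedBy
  simp only [Finset.mem_singleton]
  by_cases h : (inp τ).user ∈ C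
  · rw [Finset.sum_eq_single (inp τ).user]
    · simp [h]
    · intro v _ hv
      simp [hv.symm, hF]
    · intro h'
      exact absurd h h'
  · rw [if_neg h, hF]
    refine Finset.sum_eq_zero fun v hv => ?_
    rw [if_neg (by rintro rfl; exact h hv), hF]

lemma sum_noiseOf (C : Finset U) (s r : ℕ) :
    ∑ v ∈ C, noiseOf cl θ P inp {v} s r = noiseOf cl θ P inp C s r := by
  unfold noiseOf
  rw [Finset.sum_comm]
  exact Finset.sum_congr rfl fun τ _ => sum_playedBy _ (noiseSum_nil _ _ _) C τ

lemma sum_gramOf (C : Finset U) (s r : ℕ) :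
    ∑ v ∈ C, gramOf P inp {v} s r = gramOf P inp C s r := by
  unfold gramOf
  rw [Finset.sum_comm]
  exact Finset.sum_congr rfl fun τ _ => sum_playedBy _ (gramSum_nil _ _) C τ

lemma gramOf_eq_zero {v : U} {s r : ℕ} (h : ∀ τ ∈ Finset.Ioc s r, (inp τ).user ≠ v) :
    gramOf P inp {v} s r = 0 :=
  Finset.sum_eq_zero fun τ hτ => by simp [playedBy, h τ hτ, gramSum_nil]

lemma noiseOf_eq_zero {v : U} {s r : ℕ} (h : ∀ τ ∈ Finset.Ioc s r, (inp τ).user ≠ v) :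
    noiseOf cl θ P inp {v} s r = 0 :=
  Finset.sum_eq_zero fun τ hτ => by simp [playedBy, h τ hτ, noiseSum_nil]

lemma gramOf_succ_of_ne {v : U} {s t : ℕ} (hst : s ≤ t) (h : (inp (t + 1)).user ≠ v) :
    gramOf P inp {v} s (t + 1) = gramOf P inp {v} s t := by
  rw [← gramOf_add {v} hst t.le_succ, gramOf_eq_zero (s := t), add_zero]
  intro τ hτ
  rw [Finset.mem_Ioc] at hτ
  rwa [show τ = t + 1 by omega]

lemma noiseOf_succ_of_ne {v : U} {s t : ℕ} (hst : s ≤ t) (h : (inp (t + 1)).user ≠ v) :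
    noiseOf cl θ P inp {v} s (t + 1) = noiseOf cl θ P inp {v} s t := by
  rw [← noiseOf_add {v} hst t.le_succ, noiseOf_eq_zero (s := t), add_zero]
  intro τ hτ
  rw [Finset.mem_Ioc] at hτ
  rwa [show τ = t + 1 by omega]

lemma gramOf_succ_user {s t : ℕ} (hst : s ≤ t) :
    gramOf P inp {(inp (t + 1)).user} s (t + 1) = gramOf P inp {(inp (t + 1)).user} s t
      + ((obs P (inp (t + 1)) (stateAt P inp (t + 1))).map fun i =>
          vecMulVec ((inp (t + 1)).x i) ((inp (t + 1)).x i)).sum := by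
  simp only [gramOf]
  rw [Finset.sum_Ioc_succ_top hst]
  simp [playedBy, gramSum, obs]

/-- The clicks split into noise and signal. -/
lemma sum_click_smul (w : Fin m → Bool) (ϑ : Fin d → ℝ) (x : Fin m → Fin d → ℝ)
    (l : List (Fin m)) :
    (l.map fun i => (if w i then (1 : ℝ) else 0) • x i).sum
      = (l.map fun i => (click (w i) - ϑ ⬝ᵥ x i) • x i).sum
        + (l.map fun i => vecMulVec (x i) (x i)).sum *ᵥ ϑ := by
  induction l with
  | nil => simp
  | cons i l ih =>
    simp only [List.map_cons, List.sum_cons, ih, add_mulVec, vecMulVec_mulVec, op_smul_eq_smul,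
      dotProduct_comm (x i) ϑ, sub_smul, click]
    abel

lemma noiseOf_succ_user {s t : ℕ} (hst : s ≤ t) :
    noiseOf cl θ P inp {(inp (t + 1)).user} s (t + 1)
        + gramOf P inp {(inp (t + 1)).user} s (t + 1) *ᵥ θ (cl (inp (t + 1)).user)
      = noiseOf cl θ P inp {(inp (t + 1)).user} s t
        + gramOf P inp {(inp (t + 1)).user} s t *ᵥ θ (cl (inp (t + 1)).user)
        + ((obs P (inp (t + 1)) (stateAt P inp (t + 1))).map fun i =>
            (if (inp (t + 1)).w i then (1 : ℝ) else 0) • (inp (t + 1)).x i).sum := by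
  rw [gramOf_succ_user hst, sum_click_smul _ (θ (cl (inp (t + 1)).user)), add_mulVec]
  simp only [noiseOf]
  rw [Finset.sum_Ioc_succ_top hst]
  simp only [playedBy, noiseSum, obs, clickMean, Finset.mem_singleton, if_true]
  abel

end Data

/-! ### The last communication round -/

lemma lastComm_zero (v : U) : lastComm P inp v 0 = 0 := by simp [lastComm]

lemma lastComm_succ_of_comm {v : U} {t : ℕ} (h : AgentComm P inp v (t + 1)) :
    lastComm P inp v (t + 1) = t + 1 := by
  classical
  unfold lastComm
  refine le_antisymm (Finset.sup_le fun s hs => ?_) (Finset.le_sup (f := id) ?_)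
  · simp at hs ⊢; omega
  · simp [h]

lemma lastComm_succ_of_not_comm {v : U} {t : ℕ} (h : ¬ AgentComm P inp v (t + 1)) :
    lastComm P inp v (t + 1) = lastComm P inp v t := by
  classical
  unfold lastComm
  congr 1
  ext s
  simp only [Finset.mem_filter, Finset.mem_Icc]
  refine ⟨fun hs => ⟨⟨hs.1.1, ?_⟩, hs.2⟩, fun hs => ⟨⟨hs.1.1, by omega⟩, hs.2⟩⟩
  have : s ≠ t + 1 := fun hh => h (hh ▸ hs.2)
  omega

lemma lastComm_le (v : U) (t : ℕ) : lastComm P inp v t ≤ t := by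
  classical
  unfold lastComm
  exact Finset.sup_le fun s hs => by simp at hs ⊢; omega

lemma lastComm_mono (v : U) : Monotone (lastComm P inp v) := by
  classical
  intro a b hab
  unfold lastComm
  refine Finset.sup_mono fun s => ?_
  simp only [Finset.mem_filter, Finset.mem_Icc]
  exact fun h => ⟨⟨h.1.1, by omega⟩, h.2⟩

lemma agentComm_lastComm {v : U} {t : ℕ} (h : 1 ≤ lastComm P inp v t) :
    AgentComm P inp v (lastComm P inp v t) := by
  induction t with
  | zero => simp [lastComm_zero] at h
  | succ t ih =>
    by_cases hc : AgentComm P inp v (t + 1)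
    · rwa [lastComm_succ_of_comm hc]
    · rw [lastComm_succ_of_not_comm hc] at h ⊢
      exact ih h

lemma lastComm_eq_self {v : U} {s : ℕ} (hs : 1 ≤ s) (h : AgentComm P inp v s) :
    lastComm P inp v s = s := by
  obtain ⟨s, rfl⟩ : ∃ k, s = k + 1 := ⟨s - 1, by omega⟩
  exact lastComm_succ_of_comm h

/-! ### Invariants of the algorithm -/

lemma stateAt_succ_of_comm {v : U} {t : ℕ} (h : AgentComm P inp v (t + 1)) :
    stateAt P inp (t + 2) = commStep P (inp (t + 1)) (stateAt P inp (t + 1)) :=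
  if_pos h.2

lemma stateAt_succ_of_not_comm {v : U} {t : ℕ} (hu : (inp (t + 1)).user = v)
    (h : ¬ AgentComm P inp v (t + 1)) :
    stateAt P inp (t + 2) = localStep P (inp (t + 1)) (stateAt P inp (t + 1)) :=
  if_neg fun hc => h ⟨hu, hc⟩

lemma step_fields_of_ne {v : U} {t : ℕ} {i : RoundInput U m d} {st : AlgState U d}
    (hu : i.user ≠ v) :
    (step P t i st).gram v = st.gram v ∧ (step P t i st).est v = st.est v ∧
      (step P t i st).locGram v = st.locGram v ∧ (step P t i st).locVec v = st.locVec v ∧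
      (step P t i st).serGram v = st.serGram v ∧ (step P t i st).serVec v = st.serVec v := by
  unfold step
  split_ifs <;> simp [commStep, localStep, Function.update_of_ne hu.symm]

section Invariants
variable {J : ℕ} {cl : U → Fin J} {θ : Fin J → Fin d → ℝ}

/-- The server holds the data of agent `v` up to its last communication round, and the agent holds
the data collected since. -/
lemma stored_data (cl : U → Fin J) (θ : Fin J → Fin d → ℝ) (v : U) (t : ℕ) :
    (stateAt P inp (t + 1)).serGram v = gramOf P inp {v} 0 (lastComm P inp v t) ∧
    (stateAt P inp (t + 1)).locGram v = gramOf P inp {v} (lastComm P inp v t) t ∧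
    (stateAt P inp (t + 1)).serVec v = noiseOf cl θ P inp {v} 0 (lastComm P inp v t)
      + gramOf P inp {v} 0 (lastComm P inp v t) *ᵥ θ (cl v) ∧
    (stateAt P inp (t + 1)).locVec v = noiseOf cl θ P inp {v} (lastComm P inp v t) t
      + gramOf P inp {v} (lastComm P inp v t) t *ᵥ θ (cl v) := by
  induction t with
  | zero => simp [stateAt, initState, lastComm_zero, gramOf_self, noiseOf_self]
  | succ t ih =>
    obtain ⟨h1, h2, h3, h4⟩ := ih
    have hle := lastComm_le (P := P) (inp := inp) v t
    by_cases hu : (inp (t + 1)).user = v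
    · subst hu
      have hG : newLocGram P (inp (t + 1)) (stateAt P inp (t + 1))
          = gramOf P inp {(inp (t + 1)).user} (lastComm P inp (inp (t + 1)).user t) (t + 1) := by
        rw [gramOf_succ_user hle, newLocGram, h2]
      have hV : newLocVec P (inp (t + 1)) (stateAt P inp (t + 1))
          = noiseOf cl θ P inp {(inp (t + 1)).user} (lastComm P inp (inp (t + 1)).user t) (t + 1)
            + gramOf P inp {(inp (t + 1)).user} (lastComm P inp (inp (t + 1)).user t) (t + 1)
              *ᵥ θ (cl (inp (t + 1)).user) := by
        rw [noiseOf_succ_user hle, newLocVec, h4]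
      by_cases hc : AgentComm P inp (inp (t + 1)).user (t + 1)
      · rw [stateAt_succ_of_comm hc, lastComm_succ_of_comm hc, gramOf_self, noiseOf_self]
        simp only [commStep, Function.update_self, h1, h3, hG, hV, zero_mulVec, add_zero, true_and,
          and_true]
        refine ⟨gramOf_add _ (Nat.zero_le _) (by omega), ?_⟩
        rw [← gramOf_add _ (Nat.zero_le _) (hle.trans t.le_succ),
          ← noiseOf_add _ (Nat.zero_le _) (hle.trans t.le_succ), add_mulVec]
        abel
      · rw [stateAt_succ_of_not_comm rfl hc, lastComm_succ_of_not_comm hc]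
        simp only [localStep, Function.update_self, h1, h3, hG, hV, and_self]
    · have hc : ¬ AgentComm P inp v (t + 1) := fun h => hu h.1
      obtain ⟨-, -, e1, e2, e3, e4⟩ := step_fields_of_ne (P := P) (t := t + 1)
        (st := stateAt P inp (t + 1)) hu
      rw [lastComm_succ_of_not_comm hc, gramOf_succ_of_ne hle hu, noiseOf_succ_of_ne hle hu]
      exact ⟨e3.trans h1, e1.trans h2, e4.trans h3, e2.trans h4⟩

/-- Before its first communication an agent has the Gram matrix `0`, so its error norm vanishes. -/
lemma gram_of_not_communicated {v : U} {t : ℕ} (h : lastComm P inp v t = 0) :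
    (stateAt P inp (t + 1)).gram v = 0 := by
  induction t with
  | zero => rfl
  | succ t ih =>
    have hc : ¬ AgentComm P inp v (t + 1) := fun hc => by
      rw [lastComm_succ_of_comm hc] at h; omega
    rw [lastComm_succ_of_not_comm hc] at h
    by_cases hu : (inp (t + 1)).user = v
    · rw [stateAt_succ_of_not_comm hu hc]
      exact ih h
    · exact (step_fields_of_ne (P := P) (t := t + 1) hu).1.trans (ih h)

/-- An agent keeps the aggregate that it received in its last communication round. -/
lemma gram_est_eq_of_communicated {v : U} {t : ℕ} (h : 1 ≤ lastComm P inp v t) :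
    (stateAt P inp (t + 1)).gram v = P.lam • 1
        + ∑ v' ∈ component (stateAt P inp (lastComm P inp v t)).graph v,
          (stateAt P inp (lastComm P inp v t + 1)).serGram v' ∧
      (stateAt P inp (t + 1)).est v = ((stateAt P inp (t + 1)).gram v)⁻¹ *ᵥ
        ∑ v' ∈ component (stateAt P inp (lastComm P inp v t)).graph v,
          (stateAt P inp (lastComm P inp v t + 1)).serVec v' := by
  induction t with
  | zero => simp [lastComm_zero] at h
  | succ t ih =>
    by_cases hc : AgentComm P inp v (t + 1)
    · rw [lastComm_succ_of_comm hc, stateAt_succ_of_comm hc]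
      obtain ⟨hu, -⟩ := hc
      subst hu
      simp [commStep]
    · rw [lastComm_succ_of_not_comm hc] at h ⊢
      by_cases hu : (inp (t + 1)).user = v
      · rw [stateAt_succ_of_not_comm hu hc]
        exact ih h
      · obtain ⟨e1, e2, -⟩ := step_fields_of_ne (P := P) (t := t + 1)
          (st := stateAt P inp (t + 1)) hu
        obtain ⟨h1, h2⟩ := ih h
        exact ⟨e1.trans h1, e2.trans (by rw [h2]; exact congrArg (fun M => M⁻¹ *ᵥ _) e1.symm)⟩

lemma posDef_gram_of_communicated (hlam : 0 < P.lam) {v : U} {t : ℕ}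
    (h : 1 ≤ lastComm P inp v t) : ((stateAt P inp (t + 1)).gram v).PosDef := by
  rw [(gram_est_eq_of_communicated h).1]
  refine posDef_smul_one_add hlam (posSemidef_sum _ fun v' _ => ?_)
  rw [(stored_data (fun _ => (0 : Fin 1)) 0 v' _).1]
  exact posSemidef_gramOf _ _ _ _ _

/-- The determinant test keeps the determinant of the Gram matrix with the local data below
`1 + αc` times that of the Gram matrix. -/
lemma det_gram_add_locGram_le (hd : 0 < d) (hα : 0 < P.αc) (hlam : 0 < P.lam) (v : U) (t : ℕ) :
    ((stateAt P inp (t + 1)).gram v + (stateAt P inp (t + 1)).locGram v).det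
      ≤ (1 + P.αc) * ((stateAt P inp (t + 1)).gram v).det := by
  induction t with
  | zero =>
    have : Nonempty (Fin d) := ⟨⟨0, hd⟩⟩
    simp [stateAt, initState, det_zero]
  | succ t ih =>
    by_cases hu : (inp (t + 1)).user = v
    · by_cases hc : AgentComm P inp v (t + 1)
      · have h0 : (stateAt P inp (t + 2)).locGram v = 0 := by
          rw [stateAt_succ_of_comm hc]
          simp [commStep, hu]
        have hdet := (posDef_gram_of_communicated (P := P) (inp := inp) hlam (v := v) (t := t + 1)
          (by rw [lastComm_succ_of_comm hc]; omega)).det_pos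
        rw [h0, add_zero]
        nlinarith
      · rw [stateAt_succ_of_not_comm hu hc]
        subst hu
        simp only [localStep, Function.update_self]
        by_contra hcon
        exact hc ⟨rfl, Or.inl (not_le.1 hcon)⟩
    · obtain ⟨e1, -, e2, -⟩ := step_fields_of_ne (P := P) (t := t + 1)
        (st := stateAt P inp (t + 1)) hu
      change ((step P (t + 1) (inp (t + 1)) (stateAt P inp (t + 1))).gram v
        + (step P (t + 1) (inp (t + 1)) (stateAt P inp (t + 1))).locGram v).det ≤ (1 + P.αc) *
          ((step P (t + 1) (inp (t + 1)) (stateAt P inp (t + 1))).gram v).det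
      rw [e1, e2]
      exact ih

end Invariants

/-! ### The error of the estimate -/

lemma abs_dotProduct_le {V : Matrix (Fin d) (Fin d) ℝ} (hV : V.PosDef) {e s : Fin d → ℝ} {a b : ℝ}
    (ha : s ⬝ᵥ (V⁻¹ *ᵥ s) ≤ a) (hb : e ⬝ᵥ (V *ᵥ e) ≤ b) : |e ⬝ᵥ s| ≤ √a * √b := by
  have h1 := quadForm_nonneg hV.inv.posSemidef s
  rw [← Real.sqrt_mul (h1.trans ha)]
  exact Real.abs_le_sqrt ((dotProduct_sq_le hV e s).trans
    (mul_le_mul ha hb (quadForm_nonneg hV.posSemidef e) (h1.trans ha)))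

lemma quadForm_gramOf_mono (C : Finset U) {a b : ℕ} (hab : a ≤ b) (e : Fin d → ℝ) :
    e ⬝ᵥ (gramOf P inp C 0 a *ᵥ e) ≤ e ⬝ᵥ (gramOf P inp C 0 b *ᵥ e) := by
  rw [← gramOf_add C (Nat.zero_le a) hab, add_mulVec, dotProduct_add]
  linarith [quadForm_nonneg (posSemidef_gramOf P inp C a b) e]

lemma quadForm_smul_one_add (c : ℝ) (G : Matrix (Fin d) (Fin d) ℝ) (e : Fin d → ℝ) :
    e ⬝ᵥ ((c • (1 : Matrix (Fin d) (Fin d) ℝ) + G) *ᵥ e) = c * (e ⬝ᵥ e) + e ⬝ᵥ (G *ᵥ e) := by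
  rw [add_mulVec, smul_mulVec, one_mulVec, dotProduct_add, dotProduct_smul, smul_eq_mul]

lemma l2norm_sq (v : Fin d → ℝ) : l2norm v ^ 2 = v ⬝ᵥ v := by
  rw [l2norm, EuclideanSpace.norm_sq_eq]
  simp [dotProduct, sq]

/-- The deterministic part of the argument. The uploaded noise is the noise of the whole cluster
minus the noise that its agents have not uploaded. The determinant test bounds the Gram matrix of
the latter by `αc` times the Gram matrix held by the agent, hence by `αc` times that of `u`. -/
theorem matNorm_est_sub_le {J : ℕ} {cl : U → Fin J} {θ : Fin J → Fin d → ℝ} (hd : 0 < d)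
    (hα : 0 < P.αc) (hlam : 0 < P.lam) (hθ : ∀ j, l2norm (θ j) ≤ 1) {u : U} {t : ℕ}
    (hcor : ClusterCorrect cl P inp u (t + 1)) (hr : 1 ≤ lastComm P inp u t) {A : ℝ}
    (hglob : noiseOf cl θ P inp (Finset.univ.filter fun v => cl v = cl u) 0 (lastComm P inp u t) ⬝ᵥ
      (((P.αc * P.lam) • 1 + gramOf P inp (Finset.univ.filter fun v => cl v = cl u) 0
        (lastComm P inp u t))⁻¹ *ᵥ noiseOf cl θ P inp
          (Finset.univ.filter fun v => cl v = cl u) 0 (lastComm P inp u t)) ≤ A / 4)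
    (hloc : ∀ v, ∀ s < lastComm P inp u t, noiseOf cl θ P inp {v} s (lastComm P inp u t) ⬝ᵥ
      (((P.αc * P.lam) • 1 + gramOf P inp {v} s (lastComm P inp u t))⁻¹ *ᵥ
        noiseOf cl θ P inp {v} s (lastComm P inp u t)) ≤ A / 4) :
    matNorm ((stateAt P inp (t + 1)).gram u) ((stateAt P inp (t + 1)).est u - θ (cl u))
      ≤ √P.lam + (√(1 + Fintype.card U * P.αc) + Fintype.card U * √(2 * P.αc)) * √A := by
  set r := lastComm P inp u t with hrdef
  set C : Finset U := Finset.univ.filter fun v => cl v = cl u with hC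
  set N : U → ℕ := fun v => lastComm P inp v r with hN
  have hNr : ∀ v, N v ≤ r := fun v => lastComm_le v r
  have hcomm : AgentComm P inp u r := agentComm_lastComm hr
  have hur : lastComm P inp u r = r := lastComm_eq_self hr hcomm
  simp only [ClusterCorrect, Nat.add_sub_cancel, ← hrdef] at hcor
  have hser : ∀ v, (stateAt P inp (r + 1)).serGram v = gramOf P inp {v} 0 (N v) := fun v =>
    (stored_data cl θ v r).1
  have hserV : ∀ v, (stateAt P inp (r + 1)).serVec v = noiseOf cl θ P inp {v} 0 (N v)
      + gramOf P inp {v} 0 (N v) *ᵥ θ (cl v) := fun v => (stored_data cl θ v r).2.2.1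
  have hcompu : component (stateAt P inp r).graph u = C := by
    have := (hcor u rfl ⟨r, by simp; omega, hcomm.1⟩).2
    rwa [hur] at this
  obtain ⟨hgram, hest⟩ := gram_est_eq_of_communicated (P := P) (inp := inp) (v := u) (t := t) hr
  rw [← hrdef, hcompu] at hgram hest
  set M := (stateAt P inp (t + 1)).gram u with hM
  simp only [hser] at hgram
  simp only [hserV] at hest
  have hMpd : M.PosDef := posDef_gram_of_communicated hlam hr
  set e := (stateAt P inp (t + 1)).est u - θ (cl u) with he
  set Q := e ⬝ᵥ (M *ᵥ e) with hQ
  have hQ0 : 0 ≤ Q := quadForm_nonneg hMpd.posSemidef e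
  have hee : 0 ≤ e ⬝ᵥ e := by rw [← l2norm_sq]; positivity
  -- the quadratic form of `M`, and the normal equation for the error `e`
  have hQeq : Q = P.lam * (e ⬝ᵥ e) + ∑ v ∈ C, e ⬝ᵥ (gramOf P inp {v} 0 (N v) *ᵥ e) := by
    rw [hQ, hgram, quadForm_smul_one_add, sum_mulVec, dotProduct_sum]
  have hsum0 : 0 ≤ ∑ v ∈ C, e ⬝ᵥ (gramOf P inp {v} 0 (N v) *ᵥ e) :=
    Finset.sum_nonneg fun v _ => quadForm_nonneg (posSemidef_gramOf P inp {v} 0 (N v)) e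
  have hlamQ : P.lam * (e ⬝ᵥ e) ≤ Q := by linarith
  have hMe : M *ᵥ e = ∑ v ∈ C, noiseOf cl θ P inp {v} 0 (N v) - P.lam • θ (cl u) := by
    rw [he, mulVec_sub, hest, mulVec_mulVec, mul_nonsing_inv _ (isUnit_det_of_posDef hMpd),
      one_mulVec, hgram, add_mulVec, sum_mulVec, smul_mulVec, one_mulVec, Finset.sum_add_distrib]
    have : ∑ v ∈ C, gramOf P inp {v} 0 (N v) *ᵥ θ (cl v)
        = ∑ v ∈ C, gramOf P inp {v} 0 (N v) *ᵥ θ (cl u) :=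
      Finset.sum_congr rfl fun v hv => by rw [(Finset.mem_filter.1 hv).2]
    rw [this]
    abel
  have hnoise : ∑ v ∈ C, noiseOf cl θ P inp {v} 0 (N v)
      = noiseOf cl θ P inp C 0 r - ∑ v ∈ C, noiseOf cl θ P inp {v} (N v) r := by
    rw [← sum_noiseOf C 0 r, ← Finset.sum_sub_distrib]
    refine Finset.sum_congr rfl fun v _ => ?_
    rw [← noiseOf_add {v} (Nat.zero_le (N v)) (hNr v), add_sub_cancel_right]
  -- the data that the agents of the cluster have not uploaded
  have hlocG : ∀ v ∈ C, e ⬝ᵥ (gramOf P inp {v} (N v) r *ᵥ e) ≤ P.αc * Q := by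
    intro v hv
    have hvc : cl v = cl u := (Finset.mem_filter.1 hv).2
    by_cases hact : ∃ s ∈ Finset.Icc 1 r, (inp s).user = v
    · obtain ⟨hN1, hcv⟩ := hcor v hvc hact
      have hdet := det_gram_add_locGram_le (P := P) (inp := inp) hd hα hlam v r
      rw [(stored_data cl θ v r).2.1] at hdet
      have hle := quadForm_le_of_det_le
        (posDef_gram_of_communicated (P := P) (inp := inp) hlam hN1)
        (posSemidef_gramOf P inp {v} (N v) r) hdet e
      refine hle.trans (mul_le_mul_of_nonneg_left ?_ hα.le)
      -- the aggregate of `v` is over the same cluster, at the earlier round `N v ≤ r`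
      rw [(gram_est_eq_of_communicated hN1).1, hcv, quadForm_smul_one_add, sum_mulVec,
        dotProduct_sum, hQeq, ← hC]
      refine add_le_add le_rfl (Finset.sum_le_sum fun v' _ => ?_)
      rw [(stored_data cl θ v' _).1]
      exact quadForm_gramOf_mono {v'} (lastComm_mono v' (hNr v)) e
    · rw [gramOf_eq_zero fun τ hτ hu => hact ⟨τ, by simp at hτ ⊢; omega, hu⟩]
      simp only [zero_mulVec, dotProduct_zero]
      positivity
  have hρ : 0 < P.αc * P.lam := mul_pos hα hlam
  have hcard : (1 : ℝ) ≤ Fintype.card U := by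
    exact_mod_cast Fintype.card_pos_iff.2 ⟨u⟩
  have hCcard : (C.card : ℝ) ≤ Fintype.card U := by exact_mod_cast Finset.card_le_univ C
  have hρe : P.αc * P.lam * (e ⬝ᵥ e) ≤ P.αc * Q := by
    rw [mul_assoc]; exact mul_le_mul_of_nonneg_left hlamQ hα.le
  have hlocN : ∀ v ∈ C, |e ⬝ᵥ noiseOf cl θ P inp {v} (N v) r| ≤ √(2 * P.αc) * √A * √Q := by
    intro v hv
    rcases (hNr v).eq_or_lt with h | h
    · rw [h, noiseOf_self]
      simp only [dotProduct_zero, abs_zero]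
      positivity
    · refine (abs_dotProduct_le (posDef_smul_one_add hρ (posSemidef_gramOf P inp {v} (N v) r))
        (hloc v (N v) h) (b := 2 * P.αc * Q) ?_).trans ?_
      · rw [quadForm_smul_one_add]
        linarith [hlocG v hv]
      · rw [Real.sqrt_mul (by positivity) Q, ← mul_assoc, mul_comm (√(A / 4))]
        refine mul_le_mul_of_nonneg_right (mul_le_mul_of_nonneg_left ?_ (Real.sqrt_nonneg _))
          (Real.sqrt_nonneg _)
        rw [Real.sqrt_div' _ (by norm_num)]
        exact div_le_self (Real.sqrt_nonneg _) (by simp)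
  -- a regularizer `αc λ` instead of `λ` loses at most a factor `2`, made up for by `A / 4`
  have hglobN : |e ⬝ᵥ noiseOf cl θ P inp C 0 r| ≤ √(1 + Fintype.card U * P.αc) * √A * √Q := by
    refine (abs_dotProduct_le (posDef_smul_one_add hρ (posSemidef_gramOf P inp C 0 r))
      hglob (b := 4 * ((1 + Fintype.card U * P.αc) * Q)) ?_).trans (le_of_eq ?_)
    · rw [quadForm_smul_one_add, ← sum_gramOf, sum_mulVec, dotProduct_sum]
      have h1 : ∑ v ∈ C, e ⬝ᵥ (gramOf P inp {v} 0 r *ᵥ e)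
          ≤ Q + Fintype.card U * (P.αc * Q) := by
        have h2 : ∀ v ∈ C, e ⬝ᵥ (gramOf P inp {v} 0 r *ᵥ e)
            ≤ e ⬝ᵥ (gramOf P inp {v} 0 (N v) *ᵥ e) + P.αc * Q := fun v hv => by
          rw [← gramOf_add {v} (Nat.zero_le (N v)) (hNr v), add_mulVec, dotProduct_add]
          linarith [hlocG v hv]
        refine (Finset.sum_le_sum h2).trans ?_
        rw [Finset.sum_add_distrib, Finset.sum_const, nsmul_eq_mul]
        have h3 : (C.card : ℝ) * (P.αc * Q) ≤ Fintype.card U * (P.αc * Q) :=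
          mul_le_mul_of_nonneg_right hCcard (by positivity)
        nlinarith [mul_nonneg hlam.le hee]
      have h4 : P.αc * Q ≤ Fintype.card U * (P.αc * Q) :=
        le_mul_of_one_le_left (by positivity) hcard
      have h5 : 0 ≤ P.αc * Q := by positivity
      nlinarith
    · rw [Real.sqrt_div' _ (by norm_num), Real.sqrt_mul (by norm_num) (_ * Q),
        Real.sqrt_mul (by positivity) Q]
      field_simp
  have hθN : |P.lam * (e ⬝ᵥ θ (cl u))| ≤ √P.lam * √Q := by
    rw [← Real.sqrt_mul hlam.le]
    refine Real.abs_le_sqrt ?_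
    have hcs := dotProduct_sq_le (PosDef.one : (1 : Matrix (Fin d) (Fin d) ℝ).PosDef) e (θ (cl u))
    rw [inv_one, one_mulVec, one_mulVec, ← l2norm_sq (θ (cl u))] at hcs
    have h1 : l2norm (θ (cl u)) ^ 2 ≤ 1 := pow_le_one₀ (norm_nonneg _) (hθ _)
    have h2 : (e ⬝ᵥ θ (cl u)) ^ 2 ≤ e ⬝ᵥ e := hcs.trans (by nlinarith)
    calc (P.lam * (e ⬝ᵥ θ (cl u))) ^ 2 = P.lam * (P.lam * (e ⬝ᵥ θ (cl u)) ^ 2) := by ring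
      _ ≤ P.lam * (P.lam * (e ⬝ᵥ e)) := by gcongr
      _ ≤ P.lam * Q := by gcongr
  have hQexp : Q = e ⬝ᵥ noiseOf cl θ P inp C 0 r
      - ∑ v ∈ C, e ⬝ᵥ noiseOf cl θ P inp {v} (N v) r - P.lam * (e ⬝ᵥ θ (cl u)) := by
    rw [hQ, hMe, hnoise, dotProduct_sub, dotProduct_sub, dotProduct_sum, dotProduct_smul,
      smul_eq_mul]
  have hlocsum : |∑ v ∈ C, e ⬝ᵥ noiseOf cl θ P inp {v} (N v) r|
      ≤ Fintype.card U * (√(2 * P.αc) * √A * √Q) := by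
    refine (Finset.abs_sum_le_sum_abs _ _).trans ((Finset.sum_le_sum hlocN).trans ?_)
    rw [Finset.sum_const, nsmul_eq_mul]
    exact mul_le_mul_of_nonneg_right hCcard (by positivity)
  have hfin : √Q * √Q ≤ (√P.lam + (√(1 + Fintype.card U * P.αc)
      + Fintype.card U * √(2 * P.αc)) * √A) * √Q := by
    rw [Real.mul_self_sqrt hQ0]
    have h1 := (abs_le.1 hglobN).2
    have h2 := (abs_le.1 hlocsum).1
    have h3 := (abs_le.1 hθN).1
    calc Q ≤ √(1 + Fintype.card U * P.αc) * √A * √Q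
          + Fintype.card U * (√(2 * P.αc) * √A * √Q) + √P.lam * √Q := by linarith
      _ = _ := by ring
  change √Q ≤ _
  rcases (Real.sqrt_nonneg Q).eq_or_lt with h | h
  · rw [← h]; positivity
  · exact le_of_mul_le_mul_right hfin h

end Deterministic

/-! ### The concentration event -/

section Concentration
variable {Ω : Type*} [mΩ : MeasurableSpace Ω] {μ : Measure Ω} {J K T : ℕ} {cl : U → Fin J}
  {θ : Fin J → Fin d → ℝ} {inp : ℕ → Ω → RoundInput U m d} {ℱ : Filtration ℕ mΩ}
  {P : Params m d}

lemma trace_gramSum_le (w : Fin m → Bool) (x : Fin m → Fin d → ℝ) (l : List (Fin m))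
    (hx : ∀ i ∈ l, l2norm (x i) ≤ 1) : (gramSum w x l).trace ≤ l.length := by
  have h : ∀ l' : List (Fin m), (∀ i ∈ l', l2norm (x i) ≤ 1) →
      ((l'.map fun i => vecMulVec (x i) (x i)).sum).trace ≤ l'.length := by
    intro l' hl'
    induction l' with
    | nil => simp
    | cons i l' ih =>
      have h1 : l2norm (x i) ^ 2 ≤ 1 := pow_le_one₀ (norm_nonneg _) (hl' i (by simp))
      rw [l2norm_sq] at h1
      have h2 := ih fun j hj => hl' j (by simp [hj])
      simp only [List.map_cons, List.sum_cons, trace_add, trace_vecMulVec, List.length_cons,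
        Nat.cast_add, Nat.cast_one]
      linarith
  refine (h (observed w l) fun i hi => hx i (List.mem_of_mem_take hi)).trans ?_
  exact_mod_cast List.length_take_le' _ _

lemma IsEnvironment.trace_gramOf_le (henv : IsEnvironment μ K T cl θ inp ℱ)
    (horacle : ∀ A : Finset (List (Fin m)), A.Nonempty → ∀ W, P.oracle A W ∈ A)
    (C : Finset U) (ω : Ω) (s : ℕ) {r : ℕ} (hr : r ≤ T) :
    (gramOf P (fun τ => inp τ ω) C s r).trace ≤ K * T := by
  rw [gramOf, trace_sum]
  have h : ∀ τ ∈ Finset.Ioc s r, (gramSum (inp τ ω).w (inp τ ω).x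
      (playedBy P (fun τ => inp τ ω) C τ)).trace ≤ K := by
    intro τ hτ
    rw [Finset.mem_Ioc] at hτ
    have hmem : τ ∈ Finset.Icc 1 T := by simp; omega
    obtain ⟨-, h1, h2⟩ := henv.playedBy_spec horacle hmem C ω
    refine (trace_gramSum_le _ _ _ fun i hi => henv.x_norm τ hmem ω i (h2 i hi)).trans ?_
    exact_mod_cast h1
  refine (Finset.sum_le_sum h).trans ?_
  rw [Finset.sum_const, Nat.card_Ioc, nsmul_eq_mul, mul_comm]
  have : ((r - s : ℕ) : ℝ) ≤ T := by exact_mod_cast (Nat.sub_le r s).trans hr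
  gcongr

lemma IsEnvironment.det_le (henv : IsEnvironment μ K T cl θ inp ℱ)
    (horacle : ∀ A : Finset (List (Fin m)), A.Nonempty → ∀ W, P.oracle A W ∈ A)
    (hd : 0 < d) {ρ : ℝ} (hρ : 0 < ρ) (C : Finset U) (ω : Ω) (s : ℕ) {r : ℕ} (hr : r ≤ T) :
    (ρ • 1 + gramOf P (fun τ => inp τ ω) C s r).det ≤ ρ ^ d * (1 + K * T / (ρ * d)) ^ d := by
  have : Nonempty (Fin d) := ⟨⟨0, hd⟩⟩
  have hd' : (0 : ℝ) < d := by exact_mod_cast hd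
  have hpd := posDef_smul_one_add hρ (posSemidef_gramOf P (fun τ => inp τ ω) C s r)
  have h := det_le_trace_div_pow hpd.posSemidef
  rw [Fintype.card_fin] at h
  refine h.trans ?_
  rw [← mul_pow]
  refine pow_le_pow_left₀ (div_nonneg hpd.posSemidef.trace_nonneg hd'.le) ?_ _
  have ht := henv.trace_gramOf_le horacle C ω s hr (P := P)
  rw [trace_add, trace_smul, trace_one, Fintype.card_fin, smul_eq_mul, div_le_iff₀ hd']
  calc _ ≤ ρ * d + K * T := by linarith
    _ = _ := by field_simp

/-- The quantity under the root in the confidence radius. -/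
def logTerm (n d K T : ℕ) (ρ δ : ℝ) : ℝ :=
  d * Real.log (1 + K * T / (ρ * d)) + 2 * Real.log (1 / δ) + 4 * Real.log (T * n)

/-- The self-normalized tail bound, by Markov's inequality for the potential. -/
lemma IsEnvironment.measure_noise_gt_le [IsProbabilityMeasure μ]
    (henv : IsEnvironment μ K T cl θ inp ℱ)
    (horacle : ∀ A : Finset (List (Fin m)), A.Nonempty → ∀ W, P.oracle A W ∈ A)
    (horacle_meas : ∀ A a, MeasurableSet {W : Fin m → ℝ | P.oracle A W = a})
    (hd : 0 < d) (hT : 0 < T) {n : ℕ} (hn : 0 < n) {ρ δ : ℝ} (hρ : 0 < ρ) (hδ : 0 < δ)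
    (C : Finset U) {s r : ℕ} (hsr : s ≤ r) (hr : r ≤ T) :
    μ {ω | logTerm n d K T ρ δ / 4 < noiseOf cl θ P (fun τ => inp τ ω) C s r ⬝ᵥ
      ((ρ • 1 + gramOf P (fun τ => inp τ ω) C s r)⁻¹ *ᵥ
        noiseOf cl θ P (fun τ => inp τ ω) C s r)} ≤ ENNReal.ofReal (δ / (T * n) ^ 2) := by
  have hd' : (0 : ℝ) < d := by exact_mod_cast hd
  have hTn : (0 : ℝ) < T * n := by positivity
  set B : ℝ := 1 + K * T / (ρ * d) with hB
  have hB0 : 0 < B := by positivity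
  set ε : ℝ := δ / (T * n) ^ 2 with hε
  have hε0 : 0 < ε := by positivity
  set c : ℝ := 1 / √(ρ ^ d) with hc
  have hc0 : 0 < c := by positivity
  have hexp : Real.exp (logTerm n d K T ρ δ / 2) = √(B ^ d) / ε := by
    have h1 : Real.exp (logTerm n d K T ρ δ) = B ^ d * (1 / ε) ^ 2 := by
      have h2 : ∀ x : ℝ, 0 < x → ∀ k : ℕ, Real.exp (k * Real.log x) = x ^ k := fun x hx k => by
        rw [Real.exp_nat_mul, Real.exp_log hx]
      rw [logTerm, Real.exp_add, Real.exp_add, ← hB, h2 B hB0]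
      have h3 := h2 (1 / δ) (by positivity) 2
      have h4 := h2 (T * n) hTn 4
      norm_num only at h3 h4
      rw [h3, h4, hε]
      field_simp
    rw [Real.exp_half, h1, Real.sqrt_mul (by positivity), Real.sqrt_sq (by positivity)]
    ring
  set f : Ω → ENNReal := fun ω => ENNReal.ofReal
    (potential (noiseOf cl θ P (fun τ => inp τ ω) C s r)
      (ρ • 1 + gramOf P (fun τ => inp τ ω) C s r)) with hf
  have hfm : Measurable f := by
    have hN := (henv.measurable_noiseOf horacle_meas hr (Nat.lt_succ_self r) C s).mono
      (ℱ.le (r + 1)) le_rfl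
    have hG := (henv.measurable_gramOf horacle_meas hr (Nat.lt_succ_self r) C s).mono
      (ℱ.le (r + 1)) le_rfl
    exact (measurable_potential hN (hG.const_add _)).ennreal_ofReal
  have hmarkov := mul_meas_ge_le_lintegral (μ := μ) hfm (ENNReal.ofReal (c / ε))
  have hint := henv.lintegral_potential_le horacle horacle_meas hρ C hsr hr
  have hsub : {ω | logTerm n d K T ρ δ / 4 < noiseOf cl θ P (fun τ => inp τ ω) C s r ⬝ᵥ
      ((ρ • 1 + gramOf P (fun τ => inp τ ω) C s r)⁻¹ *ᵥ
        noiseOf cl θ P (fun τ => inp τ ω) C s r)} ⊆ {ω | ENNReal.ofReal (c / ε) ≤ f ω} := by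
    intro ω hω
    refine ENNReal.ofReal_le_ofReal ?_
    have hω' : logTerm n d K T ρ δ / 2 ≤ 2 * (noiseOf cl θ P (fun τ => inp τ ω) C s r ⬝ᵥ
      ((ρ • 1 + gramOf P (fun τ => inp τ ω) C s r)⁻¹ *ᵥ
        noiseOf cl θ P (fun τ => inp τ ω) C s r)) := by
      have : logTerm n d K T ρ δ / 4 < _ := hω
      linarith
    have hdet := henv.det_le (P := P) horacle hd hρ C ω s hr
    have hpos := (posDef_smul_one_add hρ (posSemidef_gramOf P (fun τ => inp τ ω) C s r)).det_pos
    have hsq := Real.sqrt_le_sqrt hdet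
    rw [Real.sqrt_mul (by positivity)] at hsq
    rw [potential, le_div_iff₀ (Real.sqrt_pos.2 hpos)]
    calc c / ε * √(ρ • 1 + gramOf P (fun τ => inp τ ω) C s r).det
        ≤ c / ε * (√(ρ ^ d) * √(B ^ d)) := by gcongr
      _ = √(B ^ d) / ε := by rw [hc]; field_simp
      _ ≤ _ := by rw [← hexp]; exact Real.exp_le_exp.2 hω'
  have h1 : ENNReal.ofReal (c / ε) * μ {ω | ENNReal.ofReal (c / ε) ≤ f ω}
      ≤ ENNReal.ofReal (c / ε) * ENNReal.ofReal ε := by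
    rw [← ENNReal.ofReal_mul (by positivity), div_mul_cancel₀ _ hε0.ne']
    exact hmarkov.trans hint
  refine (measure_mono hsub).trans ?_
  exact (ENNReal.mul_le_mul_iff_right (by simpa using by positivity) ENNReal.ofReal_ne_top).1 h1

end Concentration

end FedC3B

end

theorem mainTheorem2 {U : Type*} [Fintype U] [DecidableEq U] [Nonempty U]
    {Ω : Type*} [MeasurableSpace Ω] (μ : MeasureTheory.Measure Ω)
    [MeasureTheory.IsProbabilityMeasure μ]
    (m d K T J : ℕ) (hd : 0 < d) (hK : 0 < K) (hKm : K ≤ m) (hT : 0 < T)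
    (αc αd lam δ : ℝ) (hαc : 0 < αc) (hαd : 0 < αd) (hlam : 0 < lam) (hδ : 0 < δ) (hδ1 : δ < 1)
    -- the offline oracle: any measurable rule that selects a feasible action
    (oracle : Finset (List (Fin m)) → (Fin m → ℝ) → List (Fin m))
    (horacle : ∀ A : Finset (List (Fin m)), A.Nonempty → ∀ W, oracle A W ∈ A)
    (horacle_meas : ∀ A a, MeasurableSet {W : Fin m → ℝ | oracle A W = a})
    (cl : U → Fin J) (θ : Fin J → Fin d → ℝ)
    (inp : ℕ → Ω → FedC3B.RoundInput U m d)
    (ℱ : MeasureTheory.Filtration ℕ ‹MeasurableSpace Ω›)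
    (henv : FedC3B.IsEnvironment μ K T cl θ inp ℱ)
    (β : ℝ) (hβ : β = FedC3B.confRadius (Fintype.card U) d K T αc lam δ)
    (P : FedC3B.Params m d) (hP : P = ⟨αc, αd, lam, β, oracle⟩) :
    ENNReal.ofReal (1 - δ) ≤ μ {ω | ∀ t ∈ Finset.Icc 1 T, ∀ u : U,
      FedC3B.ClusterCorrect cl P (fun s => inp s ω) u t →
        FedC3B.matNorm ((FedC3B.stateAt P (fun s => inp s ω) t).gram u)
          ((FedC3B.stateAt P (fun s => inp s ω) t).est u - θ (cl u)) ≤ β} := by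
  have hPα : P.αc = αc := by rw [hP]
  have hPl : P.lam = lam := by rw [hP]
  have hPo : P.oracle = oracle := by rw [hP]
  clear hP
  rw [← hPo] at horacle horacle_meas
  set n := Fintype.card U with hn
  have hn0 : 0 < n := Fintype.card_pos
  set A := FedC3B.logTerm n d K T (αc * lam) δ with hA
  set bad : Finset U → ℕ → ℕ → Set Ω := fun C s r =>
    {ω | A / 4 < FedC3B.noiseOf cl θ P (fun τ => inp τ ω) C s r ⬝ᵥ
      (((αc * lam) • 1 + FedC3B.gramOf P (fun τ => inp τ ω) C s r)⁻¹.mulVec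
        (FedC3B.noiseOf cl θ P (fun τ => inp τ ω) C s r))} with hbad
  have hbadle : ∀ C s r, s ≤ r → r ≤ T →
      μ (bad C s r) ≤ ENNReal.ofReal (δ / (T * n) ^ 2) := fun C s r hsr hr =>
    henv.measure_noise_gt_le horacle horacle_meas hd hT hn0 (mul_pos hαc hlam) hδ C hsr hr
  -- for an end `r` and a user `v`, the index `k = 0` stands for the cluster of `v` from the first
  -- round on, and `k = s + 1` for the user `v` alone from round `s + 1` on
  set F : U → ℕ → ℕ → Set Ω := fun v r k =>
    if k = 0 then bad (Finset.univ.filter fun v' => cl v' = cl v) 0 r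
    else bad {v} (min (k - 1) r) r with hF
  -- only `r ≤ T - 1` matters, because the state of round `T` depends on the earlier rounds
  set BAD : Set Ω := ⋃ v ∈ (Finset.univ : Finset U), ⋃ r ∈ Finset.Icc 1 (T - 1),
    ⋃ k ∈ Finset.range T, F v r k with hBAD
  have hBADle : μ BAD ≤ ENNReal.ofReal δ := by
    have hT' : (0 : ℝ) < T := by exact_mod_cast hT
    have hn' : (0 : ℝ) < n := by exact_mod_cast hn0
    have h1 : μ BAD ≤ ∑ v : U, ∑ r ∈ Finset.Icc 1 (T - 1), ∑ k ∈ Finset.range T,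
        ENNReal.ofReal (δ / (T * n) ^ 2) := by
      refine (MeasureTheory.measure_biUnion_finset_le _ _).trans (Finset.sum_le_sum fun v _ => ?_)
      refine (MeasureTheory.measure_biUnion_finset_le _ _).trans (Finset.sum_le_sum fun r hr => ?_)
      refine (MeasureTheory.measure_biUnion_finset_le _ _).trans (Finset.sum_le_sum fun k _ => ?_)
      have hrT : r ≤ T := by simp at hr; omega
      simp only [hF]
      split_ifs
      · exact hbadle _ _ _ (Nat.zero_le _) hrT
      · exact hbadle _ _ _ (min_le_right _ _) hrT
    refine h1.trans ?_
    simp only [Finset.sum_const, Finset.card_univ, Nat.card_Icc, Finset.card_range, nsmul_eq_mul,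
      ← hn, Nat.add_sub_cancel]
    rw [← ENNReal.ofReal_natCast n, ← ENNReal.ofReal_natCast T, ← ENNReal.ofReal_natCast (T - 1),
      ← ENNReal.ofReal_mul (by positivity), ← ENNReal.ofReal_mul (by positivity),
      ← ENNReal.ofReal_mul (by positivity)]
    refine ENNReal.ofReal_le_ofReal ?_
    have h2 : ((T - 1 : ℕ) : ℝ) ≤ T := by exact_mod_cast Nat.sub_le T 1
    have h3 : (1 : ℝ) ≤ n := by exact_mod_cast hn0
    calc (n : ℝ) * (((T - 1 : ℕ) : ℝ) * (T * (δ / (T * n) ^ 2)))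
        ≤ n * (T * (T * (δ / (T * n) ^ 2))) := by gcongr
      _ = δ / n := by field_simp
      _ ≤ δ := div_le_self hδ.le h3
  have hgood : BADᶜ ⊆ {ω | ∀ t ∈ Finset.Icc 1 T, ∀ u : U,
      FedC3B.ClusterCorrect cl P (fun s => inp s ω) u t →
        FedC3B.matNorm ((FedC3B.stateAt P (fun s => inp s ω) t).gram u)
          ((FedC3B.stateAt P (fun s => inp s ω) t).est u - θ (cl u)) ≤ β} := by
    intro ω hω t ht u hcor
    obtain ⟨t, rfl⟩ : ∃ k, t = k + 1 := ⟨t - 1, by simp at ht; omega⟩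
    have htT : t ≤ T - 1 := by simp at ht; omega
    have hnot : ∀ v r k, r ∈ Finset.Icc 1 (T - 1) → k ∈ Finset.range T → ω ∉ F v r k := by
      intro v r k hr hk hmem
      exact hω (by
        simp only [hBAD, Set.mem_iUnion]
        exact ⟨v, Finset.mem_univ v, r, hr, k, hk, hmem⟩)
    rw [hβ]
    set r := FedC3B.lastComm P (fun s => inp s ω) u t with hr
    rcases Nat.eq_zero_or_pos r with h0 | h1
    · rw [FedC3B.gram_of_not_communicated h0, FedC3B.matNorm, Matrix.zero_mulVec,
        dotProduct_zero, Real.sqrt_zero, FedC3B.confRadius]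
      positivity
    · have hrt : r ≤ t := FedC3B.lastComm_le u t
      have hrmem : r ∈ Finset.Icc 1 (T - 1) := by simp; omega
      have hmain := FedC3B.matNorm_est_sub_le (A := A) hd (hPα ▸ hαc) (hPl ▸ hlam)
        henv.theta_norm hcor h1 ?_ ?_
      · rw [hPα, hPl] at hmain
        exact hmain
      · rw [hPα, hPl]
        have := hnot u r 0 hrmem (by simpa using hT)
        simpa [hF, hbad] using this
      · intro v s hs
        rw [hPα, hPl]
        have := hnot v r (s + 1) hrmem (by simp at hrmem ⊢; omega)
        have hmin : min s r = s := min_eq_left hs.le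
        simpa [hF, hbad, hmin] using this
  -- neither event is claimed to be measurable: subadditivity suffices
  calc ENNReal.ofReal (1 - δ) = 1 - ENNReal.ofReal δ := by
        rw [ENNReal.ofReal_sub _ hδ.le, ENNReal.ofReal_one]
    _ ≤ 1 - μ BAD := tsub_le_tsub_left hBADle 1
    _ ≤ μ BADᶜ := by
        rw [← MeasureTheory.measure_univ (μ := μ)]
        refine tsub_le_iff_right.2 ?_
        rw [← Set.compl_union_self BAD]
        exact MeasureTheory.measure_union_le _ _
    _ ≤ _ := MeasureTheory.measure_mono hgood
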